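/- Notation. For a non-zero window $g\in\mathcal S(\mathbb R^n)$, the short-time Fourier transform of $f\in\mathcal S'(\mathbb R^n)$ is $V_gf(x,\xi)=\langle f,M_\xi T_xg\rangle$, formally $\int_{\mathbb R^n} f(t)\overline{g(t-x)}e^{-2\pi i\xi\cdot t}\,dt$. For $p,q\in[1,\infty]$ and a weight $m$ on $\mathbb R^{2n}$, the modulation space $M^{p,q}_m(\mathbb R^n)$ consists of all $f\in\mathcal S'(\mathbb R^n)$ with $$\|f\|_{M^{p,q}_m}=\Big(\int_{\mathbb R^n}\Big(\int_{\mathbb R^n}|V_gf(x,\xi)|^p\,m(x,\xi)^p\,dx\Big)^{q/p}d\xi\Big)^{1/q}<\infty$$ (with the usual changes if $p=\infty$ or $q=\infty$); $M^{p,q}$ denotes the case $m\equiv1$. Let $v_s(z)=(1+|z|^2)^{s/2}$ for $z\in\mathbb R^{2d}$, and $(1\otimes v_s)(z,\zeta)=v_s(\zeta)$ for $z,\zeta\in\mathbb R^{2d}$. The cross-Wigner distribution $W(f_1,f_2)\in\mathcal S'(\mathbb R^{2d})$ of $f_1,f_2\in\mathcal S'(\mathbb R^d)$ is the extension to tempered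 distributions of $$W(f_1,f_2)(x,\xi)=\int_{\mathbb R^d} f_1\big(x+\tfrac t2\big)\overline{f_2\big(x-\tfrac t2\big)}e^{-2\pi i\xi\cdot t}\,dt .$$ Theorem. Let $p_1,q_1,p_2,q_2,p,q\in[1,\infty]$ satisfy $p_i,q_i\le q$ for $i=1,2$, and $$\frac1{p_1}+\frac1{p_2}\ge\frac1p+\frac1q,\qquad \frac1{q_1}+\frac1{q_2}\ge\frac1p+\frac1q ,$$ let $s\ge0$, and fix non-zero windows $g\in\mathcal S(\mathbb R^d)$ and $\Phi\in\mathcal S(\mathbb R^{2d})$, used to compute the modulation space norms on $\mathbb R^d$ and on $\mathbb R^{2d}$ respectively. Then there is a constant $C\geq 0$ such that for all $f_1\in M^{p_1,q_1}_{v_s}(\mathbb R^d)$ and $f_2\in M^{p_2,q_2}_{v_s}(\mathbb R^d)$ one has $W(f_1,f_2)\in M^{p,q}_{1\otimes v_s}(\mathbb R^{2d})$ and $$\|W(f_1,f_2)\|_{M^{p,q}_{1\otimes v_s}}\le C\Big(\|f_1\|_{M^{p_1,q_1}}\|f_2\|_{M^{p_2,q_2}_{v_s}}+\|f_1\|_{M^{p_1,q_1}_{v_s}}\|f_2\|_{M^{p_2,q_2}}\Big).$$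 -/

import Mathlib

open scoped SchwartzMap ENNReal NNReal

noncomputable section

namespace TimeFreq

open SchwartzMap LineDeriv MeasureTheory
open scoped FourierTransform

section Tensor

variable {V : Type*} [NormedAddCommGroup V] [NormedSpace ℝ V]

theorem fderiv_iteratedFDeriv_apply (Φ : 𝓢(V, ℂ)) (m : V) (n : ℕ) (z : V) :
    fderiv ℝ (iteratedFDeriv ℝ n Φ) z m = iteratedFDeriv ℝ n (∂_{m} Φ : 𝓢(V, ℂ)) z := by
  ext v
  have hc : ∀ (a b : V) (Ψ : 𝓢(V, ℂ)), (∂_{a} (∂_{b} Ψ) : 𝓢(V, ℂ)) = ∂_{b} (∂_{a} Ψ) := by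
    intro a b Ψ
    ext x
    have hs : IsSymmSndFDerivAt ℝ Ψ x :=
      (Ψ.smooth 2).contDiffAt.isSymmSndFDerivAt (by simp)
    have hd : DifferentiableAt ℝ (fderiv ℝ Ψ) x :=
      ((Ψ.smooth 2).fderiv_right (m := 1) (by norm_num)).differentiable (by simp) x
    have h1 : ∀ a b : V, (∂_{a} (∂_{b} Ψ) : 𝓢(V, ℂ)) x = fderiv ℝ (fderiv ℝ Ψ) x a b := by
      intro a b
      rw [lineDerivOp_apply_eq_fderiv]
      have : ((∂_{b} Ψ : 𝓢(V, ℂ)) : V → ℂ) = fun y => fderiv ℝ Ψ y b := by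
        ext y; exact lineDerivOp_apply_eq_fderiv b Ψ y
      rw [this, fderiv_clm_apply hd (by fun_prop)]
      simp
    rw [h1, h1]
    exact hs a b
  have hd : ∀ w : Fin n → V, (∂_{m} (∂^{w} Φ) : 𝓢(V, ℂ)) = ∂^{w} (∂_{m} Φ : 𝓢(V, ℂ)) := by
    intro w
    induction n with
    | zero => simp
    | succ n ih =>
      rw [iteratedLineDerivOp_succ_left, iteratedLineDerivOp_succ_left, hc, ih (Fin.tail w) (Fin.tail w)]
  rw [← iteratedLineDerivOp_eq_iteratedFDeriv, ← hd,
    show fderiv ℝ (iteratedFDeriv ℝ n Φ) z m v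
      = iteratedFDeriv ℝ (n + 1) Φ z (Fin.cons m v) by
        rw [iteratedFDeriv_succ_apply_left]; simp,
    ← iteratedLineDerivOp_eq_iteratedFDeriv, iteratedLineDerivOp_succ_left]
  simp

theorem taylor_norm_le {W : Type*} [NormedAddCommGroup W] [NormedSpace ℝ W] {F : V → W}
    (hF2 : ContDiff ℝ 2 F) {y m : V} {M : ℝ} (hM : 0 ≤ M)
    (hb : ∀ z ∈ Metric.closedBall y ‖m‖, ‖iteratedFDeriv ℝ 2 F z‖ ≤ M) :
    ‖F (y + m) - F y - fderiv ℝ F y m‖ ≤ M * ‖m‖ ^ 2 := by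
  have hF1 : ContDiff ℝ 1 (fderiv ℝ F) := hF2.fderiv_right (by norm_num)
  have hb' : ∀ z ∈ Metric.closedBall y ‖m‖, ‖fderiv ℝ (fderiv ℝ F) z‖ ≤ M := by
    intro z hz
    rw [← norm_iteratedFDeriv_one (𝕜 := ℝ), norm_iteratedFDeriv_fderiv]
    exact hb z hz
  have hconv := convex_closedBall y ‖m‖
  have hy : y ∈ Metric.closedBall y ‖m‖ := by simp
  have hym : y + m ∈ Metric.closedBall y ‖m‖ := by simp
  have h1 : ∀ z ∈ Metric.closedBall y ‖m‖, ‖fderiv ℝ F z - fderiv ℝ F y‖ ≤ M * ‖m‖ := by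
    intro z hz
    refine (hconv.norm_image_sub_le_of_norm_fderiv_le
      (fun w _ => hF1.differentiable (by simp) w) hb' hy hz).trans ?_
    gcongr
    rw [← dist_eq_norm]; exact hz
  have h2 := hconv.norm_image_sub_le_of_norm_fderiv_le'
    (fun w _ => hF2.differentiable (by simp) w) h1 hy hym
  rw [add_sub_cancel_left] at h2
  rw [pow_two, ← mul_assoc]
  exact h2

/-- The Taylor remainder `Φ(· + m) - Φ - ∂_m Φ`. -/
def taylorRem (Φ : 𝓢(V, ℂ)) (m : V) : 𝓢(V, ℂ) :=
  compSubConstCLM ℂ (-m) Φ - Φ - ∂_{m} Φ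

theorem taylorRem_seminorm_le (Φ : 𝓢(V, ℂ)) (k n : ℕ) :
    ∃ C : ℝ, 0 ≤ C ∧ ∀ m : V, ‖m‖ ≤ 1 →
      SchwartzMap.seminorm ℂ k n (taylorRem Φ m) ≤ C * ‖m‖ ^ 2 := by
  set S : ℝ := 2 ^ k * ((Finset.Iic (k, n + 2)).sup
    fun m => SchwartzMap.seminorm ℂ (E := V) (F := ℂ) m.1 m.2) Φ with hS
  have hS0 : 0 ≤ S := by positivity
  refine ⟨2 ^ k * S, by positivity, fun m hm => ?_⟩
  refine SchwartzMap.seminorm_le_bound ℂ k n _ (by positivity) fun y => ?_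
  set F := iteratedFDeriv ℝ n Φ with hF
  have hF2 : ContDiff ℝ 2 F := (Φ.smooth ((2 + n : ℕ) : ℕ∞)).iteratedFDeriv_right (by simp)
  have e : iteratedFDeriv ℝ n (taylorRem Φ m) y = F (y + m) - F y - fderiv ℝ F y m := by
    rw [fderiv_iteratedFDeriv_apply]
    have h1 : (taylorRem Φ m : V → ℂ)
        = ((fun z => Φ (z + m)) - Φ) - (∂_{m} Φ : 𝓢(V, ℂ)) := by
      ext z; simp [taylorRem]
    have c1 : ContDiff ℝ n (fun z => Φ (z + m)) :=
      (Φ.smooth n).comp (contDiff_id.add contDiff_const)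
    rw [h1, iteratedFDeriv_sub_apply (f := (fun z => Φ (z + m)) - (Φ : V → ℂ)) (c1.sub (Φ.smooth n)).contDiffAt
      ((∂_{m} Φ : 𝓢(V, ℂ)).smooth n).contDiffAt,
      iteratedFDeriv_sub_apply c1.contDiffAt (Φ.smooth n).contDiffAt, iteratedFDeriv_comp_add_right]
  have hpos : 0 < (1 + ‖y‖) ^ k := by positivity
  set M : ℝ := 2 ^ k * S / (1 + ‖y‖) ^ k with hM
  have hM0 : 0 ≤ M := by positivity
  have hb : ∀ z ∈ Metric.closedBall y ‖m‖, ‖iteratedFDeriv ℝ 2 F z‖ ≤ M := by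
    intro z hz
    have h1 : ‖iteratedFDeriv ℝ 2 F z‖ = ‖iteratedFDeriv ℝ (n + 2) Φ z‖ := by
      rw [← norm_iteratedFDeriv_fderiv, hF, fderiv_iteratedFDeriv,
        LinearIsometryEquiv.norm_iteratedFDeriv_comp_left, norm_iteratedFDeriv_one,
        norm_fderiv_iteratedFDeriv]
    have h2 := SchwartzMap.one_add_le_sup_seminorm_apply (𝕜 := ℂ) (m := (k, n + 2)) (k := k)
      (n := n + 2) le_rfl le_rfl Φ z
    have h3 : 1 + ‖y‖ ≤ 2 * (1 + ‖z‖) := by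
      have : ‖y‖ ≤ ‖z‖ + ‖z - y‖ := by
        have := norm_sub_le z (z - y); simpa using this
      have h4 : ‖z - y‖ ≤ 1 := by
        rw [← dist_eq_norm]; exact (Metric.mem_closedBall.1 hz).trans hm
      have := norm_nonneg z
      linarith
    rw [h1, hM, le_div_iff₀ hpos]
    calc ‖iteratedFDeriv ℝ (n + 2) Φ z‖ * (1 + ‖y‖) ^ k
        ≤ ‖iteratedFDeriv ℝ (n + 2) Φ z‖ * (2 * (1 + ‖z‖)) ^ k := by gcongr
      _ = 2 ^ k * ((1 + ‖z‖) ^ k * ‖iteratedFDeriv ℝ (n + 2) Φ z‖) := by rw [mul_pow]; ring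
      _ ≤ _ := by gcongr
  have h2 := taylor_norm_le hF2 hM0 hb
  rw [e]
  calc ‖y‖ ^ k * ‖F (y + m) - F y - fderiv ℝ F y m‖
      ≤ (1 + ‖y‖) ^ k * (M * ‖m‖ ^ 2) := by gcongr; linarith
    _ = 2 ^ k * S * ‖m‖ ^ 2 := by rw [hM]; field_simp

theorem taylorRem_sup_le (Φ : 𝓢(V, ℂ)) (s : Finset (ℕ × ℕ)) :
    ∃ C : ℝ, 0 ≤ C ∧ ∀ m : V, ‖m‖ ≤ 1 →
      s.sup (schwartzSeminormFamily ℂ V ℂ) (taylorRem Φ m) ≤ C * ‖m‖ ^ 2 := by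
  choose C hC0 hC using fun i : ℕ × ℕ => taylorRem_seminorm_le Φ i.1 i.2
  refine ⟨∑ i ∈ s, C i, Finset.sum_nonneg fun i _ => hC0 i, fun m hm => ?_⟩
  refine Seminorm.finset_sup_apply_le (by have := Finset.sum_nonneg fun i (_ : i ∈ s) => hC0 i; positivity) fun i hi => ?_
  refine (hC i m hm).trans ?_
  gcongr
  exact Finset.single_le_sum (f := C) (fun i _ => hC0 i) hi

variable {E F G : Type*} [NormedAddCommGroup E] [NormedSpace ℝ E]
  [NormedAddCommGroup F] [NormedSpace ℝ F] [NormedAddCommGroup G] [NormedSpace ℝ G]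

/-- The restriction `Ψ ↦ Ψ(x, ·)`. -/
def sliceCLM (x : E) : 𝓢(E × F, ℂ) →L[ℂ] 𝓢(F, ℂ) :=
  compCLMOfAntilipschitz ℂ (g := fun y : F => (x, y)) (K := 1)
    ((Function.HasTemperateGrowth.const ((x, 0) : E × F)).add
      (ContinuousLinearMap.inr ℝ E F).hasTemperateGrowth |> fun h => by
        convert h using 2; simp)
    (fun y y' => by simp [Prod.edist_eq])

@[simp]
theorem sliceCLM_apply (x : E) (Ψ : 𝓢(E × F, ℂ)) (y : F) : sliceCLM x Ψ y = Ψ (x, y) := rfl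

theorem sliceCLM_seminorm_le (x : E) (Ψ : 𝓢(E × F, ℂ)) (j k n : ℕ) :
    ‖x‖ ^ j * SchwartzMap.seminorm ℂ k n (sliceCLM x Ψ) ≤ SchwartzMap.seminorm ℂ (j + k) n Ψ := by
  rcases (pow_nonneg (norm_nonneg x) j).eq_or_lt with h0 | h0
  · rw [← h0, zero_mul]; positivity
  rw [mul_comm, ← le_div_iff₀ h0]
  refine SchwartzMap.seminorm_le_bound ℂ k n _ (by positivity) fun y => ?_
  rw [le_div_iff₀ h0]
  have e : (sliceCLM x Ψ : F → ℂ)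
      = (fun z => Ψ (z + (x, 0))) ∘ (ContinuousLinearMap.inr ℝ E F) := by
    ext y; simp
  have c1 : ContDiff ℝ n (fun z => Ψ (z + (x, 0))) :=
    (Ψ.smooth n).comp (contDiff_id.add contDiff_const)
  have hn : ‖iteratedFDeriv ℝ n (sliceCLM x Ψ) y‖ ≤ ‖iteratedFDeriv ℝ n Ψ (x, y)‖ := by
    rw [e, ContinuousLinearMap.iteratedFDeriv_comp_right _ c1 y le_rfl,
      iteratedFDeriv_comp_add_right]
    refine (ContinuousMultilinearMap.norm_compContinuousLinearMap_le _ _).trans ?_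
    have h1 : ‖ContinuousLinearMap.inr ℝ E F‖ ≤ 1 := ContinuousLinearMap.norm_inr_le_one ℝ E F
    have h2 : ∏ _i : Fin n, ‖ContinuousLinearMap.inr ℝ E F‖ ≤ 1 :=
      Finset.prod_le_one (fun _ _ => norm_nonneg _) fun _ _ => h1
    simpa using mul_le_of_le_one_right (norm_nonneg _) h2
  calc ‖y‖ ^ k * ‖iteratedFDeriv ℝ n (sliceCLM x Ψ) y‖ * ‖x‖ ^ j
      ≤ ‖(x, y)‖ ^ k * ‖iteratedFDeriv ℝ n Ψ (x, y)‖ * ‖(x, y)‖ ^ j := by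
        gcongr
        · exact norm_snd_le (x, y)
        · exact norm_fst_le (x, y)
    _ = ‖(x, y)‖ ^ (j + k) * ‖iteratedFDeriv ℝ n Ψ (x, y)‖ := by ring
    _ ≤ _ := SchwartzMap.le_seminorm ℂ _ _ _ _

/-- The function `(x, y) ↦ L (Ψ(x, ·)) (y)`. -/
def idTensorFun (L : 𝓢(F, ℂ) →L[ℂ] 𝓢(G, ℂ)) (Ψ : 𝓢(E × F, ℂ)) (z : E × G) : ℂ :=
  L (sliceCLM z.1 Ψ) z.2

theorem exists_seminorm_bound {X Y : Type*} [NormedAddCommGroup X] [NormedSpace ℝ X]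
    [NormedAddCommGroup Y] [NormedSpace ℝ Y] (L : 𝓢(X, ℂ) →L[ℂ] 𝓢(Y, ℂ)) (k : ℕ) :
    ∃ (s : Finset (ℕ × ℕ)) (C : ℝ), 0 ≤ C ∧ ∀ (φ : 𝓢(X, ℂ)) (y : Y),
      ‖y‖ ^ k * ‖L φ y‖ ≤ C * s.sup (schwartzSeminormFamily ℂ X ℂ) φ := by
  obtain ⟨s, C, -, h⟩ := Seminorm.bound_of_continuous (schwartz_withSeminorms ℂ X ℂ)
    ((schwartzSeminormFamily ℂ Y ℂ (k, 0)).comp L.toLinearMap)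
    (((schwartz_withSeminorms ℂ Y ℂ).continuous_seminorm (k, 0)).comp L.continuous)
  refine ⟨s, C, C.2, fun φ y => ?_⟩
  have := SchwartzMap.le_seminorm ℂ k 0 (L φ) y
  rw [norm_iteratedFDeriv_zero] at this
  exact this.trans (h φ)

theorem idTensorFun_bound (L : 𝓢(F, ℂ) →L[ℂ] 𝓢(G, ℂ)) (k : ℕ) :
    ∃ (s : Finset (ℕ × ℕ)) (C : ℝ), 0 ≤ C ∧ ∀ (Ψ : 𝓢(E × F, ℂ)) (z : E × G),
      ‖z‖ ^ k * ‖idTensorFun L Ψ z‖ ≤ C * s.sup (schwartzSeminormFamily ℂ (E × F) ℂ) Ψ := by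
  have key : ∀ j l : ℕ, ∃ (s : Finset (ℕ × ℕ)) (C : ℝ), 0 ≤ C ∧
      ∀ (Ψ : 𝓢(E × F, ℂ)) (z : E × G), ‖z.1‖ ^ j * (‖z.2‖ ^ l * ‖idTensorFun L Ψ z‖)
        ≤ C * s.sup (schwartzSeminormFamily ℂ (E × F) ℂ) Ψ := by
    intro j l
    obtain ⟨s, C, hC, h⟩ := exists_seminorm_bound L l
    refine ⟨s.image fun i => (j + i.1, i.2), C * s.card, by positivity, fun Ψ z => ?_⟩
    calc ‖z.1‖ ^ j * (‖z.2‖ ^ l * ‖idTensorFun L Ψ z‖)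
        ≤ ‖z.1‖ ^ j * (C * ∑ i ∈ s, schwartzSeminormFamily ℂ F ℂ i (sliceCLM z.1 Ψ)) := by
          refine mul_le_mul_of_nonneg_left ((h (sliceCLM z.1 Ψ) z.2).trans ?_) (by positivity)
          gcongr
          refine Seminorm.finset_sup_apply_le (Finset.sum_nonneg fun _ _ => apply_nonneg _ _)
            fun i hi => ?_
          exact Finset.single_le_sum
            (f := fun i => schwartzSeminormFamily ℂ F ℂ i (sliceCLM z.1 Ψ))
            (fun _ _ => apply_nonneg _ _) hi
      _ = C * ∑ i ∈ s, ‖z.1‖ ^ j * schwartzSeminormFamily ℂ F ℂ i (sliceCLM z.1 Ψ) := by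
          rw [Finset.mul_sum, Finset.mul_sum, Finset.mul_sum]
          exact Finset.sum_congr rfl fun i _ => by ring
      _ ≤ C * ∑ i ∈ s, ((s.image fun i => (j + i.1, i.2)).sup
            (schwartzSeminormFamily ℂ (E × F) ℂ)) Ψ := by
          gcongr with i hi
          refine (sliceCLM_seminorm_le z.1 Ψ j i.1 i.2).trans ?_
          exact Finset.le_sup (f := schwartzSeminormFamily ℂ (E × F) ℂ)
            (Finset.mem_image_of_mem (fun i : ℕ × ℕ => (j + i.1, i.2)) hi) Ψ
      _ = _ := by simp; ring
  obtain ⟨s₁, C₁, hC₁, h₁⟩ := key k 0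
  obtain ⟨s₂, C₂, hC₂, h₂⟩ := key 0 k
  refine ⟨s₁ ∪ s₂, C₁ + C₂, by positivity, fun Ψ z => ?_⟩
  have i1 := h₁ Ψ z
  have i2 := h₂ Ψ z
  simp only [pow_zero, one_mul] at i1 i2
  have m1 : s₁.sup (schwartzSeminormFamily ℂ (E × F) ℂ) Ψ
      ≤ (s₁ ∪ s₂).sup (schwartzSeminormFamily ℂ (E × F) ℂ) Ψ :=
    Finset.sup_mono (f := schwartzSeminormFamily ℂ (E × F) ℂ) Finset.subset_union_left Ψ
  have m2 : s₂.sup (schwartzSeminormFamily ℂ (E × F) ℂ) Ψ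
      ≤ (s₁ ∪ s₂).sup (schwartzSeminormFamily ℂ (E × F) ℂ) Ψ :=
    Finset.sup_mono (f := schwartzSeminormFamily ℂ (E × F) ℂ) Finset.subset_union_right Ψ
  have hz : ‖z‖ ^ k ≤ ‖z.1‖ ^ k + ‖z.2‖ ^ k := by
    rw [Prod.norm_def]
    rcases max_choice ‖z.1‖ ‖z.2‖ with h | h <;> rw [h] <;> simp
  calc ‖z‖ ^ k * ‖idTensorFun L Ψ z‖
      ≤ (‖z.1‖ ^ k + ‖z.2‖ ^ k) * ‖idTensorFun L Ψ z‖ := by gcongr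
    _ = ‖z.1‖ ^ k * ‖idTensorFun L Ψ z‖ + ‖z.2‖ ^ k * ‖idTensorFun L Ψ z‖ := by ring
    _ ≤ C₁ * s₁.sup (schwartzSeminormFamily ℂ (E × F) ℂ) Ψ
        + C₂ * s₂.sup (schwartzSeminormFamily ℂ (E × F) ℂ) Ψ := add_le_add i1 i2
    _ ≤ _ := by rw [add_mul]; gcongr

variable [FiniteDimensional ℝ E] [FiniteDimensional ℝ G]

theorem lineDerivOp_inl_eq_sum (Ψ : 𝓢(E × F, ℂ)) (a : E) :
    (∂_{((a, 0) : E × F)} Ψ : 𝓢(E × F, ℂ))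
      = ∑ i, ((Module.finBasis ℝ E).repr a i : ℂ) •
          (∂_{((Module.finBasis ℝ E i, 0) : E × F)} Ψ : 𝓢(E × F, ℂ)) := by
  ext z
  simp only [_root_.sum_apply, _root_.smul_apply, lineDerivOp_apply_eq_fderiv]
  have : ((a, 0) : E × F) = ∑ i, (Module.finBasis ℝ E).repr a i •
      ((Module.finBasis ℝ E i, 0) : E × F) := by
    conv_lhs => rw [← (Module.finBasis ℝ E).sum_repr a]
    ext <;> simp [Prod.fst_sum, Prod.snd_sum]
  rw [this, map_sum]
  simp only [map_smul, Complex.real_smul, smul_eq_mul]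

/-- The coordinates of `E × G` coming from `E`. -/
def coordFst (i : Fin (Module.finrank ℝ E)) : E × G →L[ℝ] ℝ :=
  (LinearMap.toContinuousLinearMap ((Module.finBasis ℝ E).coord i)).comp
    (ContinuousLinearMap.fst ℝ E G)

/-- The coordinates of `E × G` coming from `G`. -/
def coordSnd (i : Fin (Module.finrank ℝ G)) : E × G →L[ℝ] ℝ :=
  (LinearMap.toContinuousLinearMap ((Module.finBasis ℝ G).coord i)).comp
    (ContinuousLinearMap.snd ℝ E G)

theorem hasFDerivAt_idTensorFun (L : 𝓢(F, ℂ) →L[ℂ] 𝓢(G, ℂ)) (Ψ : 𝓢(E × F, ℂ)) (z : E × G) :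
    HasFDerivAt (idTensorFun L Ψ)
      (∑ i, (coordFst i).smulRight
          (idTensorFun L (∂_{((Module.finBasis ℝ E i, 0) : E × F)} Ψ : 𝓢(E × F, ℂ)) z)
        + ∑ i, (coordSnd i).smulRight
          (idTensorFun ((lineDerivOpCLM ℂ 𝓢(G, ℂ) (Module.finBasis ℝ G i)).comp L) Ψ z)) z := by
  obtain ⟨x, y⟩ := z
  set R : E × G → ℂ := fun w => L (sliceCLM x (taylorRem Ψ (w.1 - x, 0))) w.2 with hR
  set φ := L (sliceCLM x Ψ) with hφ
  set ψ : Fin (Module.finrank ℝ E) → 𝓢(G, ℂ) := fun i =>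
    L (sliceCLM x (∂_{((Module.finBasis ℝ E i, 0) : E × F)} Ψ : 𝓢(E × F, ℂ))) with hψ
  have e : idTensorFun L Ψ = fun w => R w + φ w.2
      + ∑ i, (Module.finBasis ℝ E).repr (w.1 - x) i • ψ i w.2 := by
    ext w
    have h1 : sliceCLM w.1 Ψ = sliceCLM x (taylorRem Ψ (w.1 - x, 0)) + sliceCLM x Ψ
        + ∑ i, ((Module.finBasis ℝ E).repr (w.1 - x) i : ℂ) •
          sliceCLM x (∂_{((Module.finBasis ℝ E i, 0) : E × F)} Ψ : 𝓢(E × F, ℂ)) := by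
      have h2 := lineDerivOp_inl_eq_sum Ψ (w.1 - x)
      have h3 : sliceCLM w.1 Ψ = sliceCLM x (compSubConstCLM ℂ (-((w.1 - x, 0) : E × F)) Ψ) := by
        ext t; simp
      rw [h3]
      simp only [taylorRem, map_sub, h2, map_sum, map_smul]
      abel
    simp only [idTensorFun, h1, map_add, map_sum, map_smul, _root_.add_apply,
      _root_.sum_apply, _root_.smul_apply]
    simp [hR, hφ, hψ]
  have hRd : HasFDerivAt R (0 : E × G →L[ℝ] ℂ) (x, y) := by
    refine Asymptotics.IsBigO.hasFDerivAt (n := 2) ?_ (by norm_num)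
    obtain ⟨s, C, hC, h⟩ := exists_seminorm_bound (L.comp (sliceCLM x)) 0
    obtain ⟨C', hC', h'⟩ := taylorRem_sup_le Ψ s
    refine Asymptotics.IsBigO.of_bound (C * C') ?_
    filter_upwards [Metric.ball_mem_nhds (x, y) one_pos] with w hw
    have n1 : ‖((w.1 - x, 0) : E × F)‖ ≤ ‖w - (x, y)‖ := by
      rw [Prod.norm_def]; simpa using norm_fst_le (w - (x, y))
    have n2 : ‖w - (x, y)‖ ≤ 1 := by
      rw [← dist_eq_norm]; exact (Metric.mem_ball.1 hw).le
    have b1 := h (taylorRem Ψ (w.1 - x, 0)) w.2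
    rw [pow_zero, one_mul] at b1
    refine b1.trans ?_
    rw [norm_pow, norm_norm, mul_assoc]
    gcongr
    refine (h' _ (n1.trans n2)).trans ?_
    gcongr
  have hφd : HasFDerivAt (fun w : E × G => φ w.2)
      ((fderiv ℝ φ y).comp (ContinuousLinearMap.snd ℝ E G)) (x, y) :=
    HasFDerivAt.comp (x, y) (φ.hasFDerivAt y) hasFDerivAt_snd
  have hψd : ∀ i, HasFDerivAt (fun w : E × G => (Module.finBasis ℝ E).repr (w.1 - x) i • ψ i w.2)
      ((coordFst i).smulRight (ψ i y)) (x, y) := by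
    intro i
    have a1 : HasFDerivAt (fun w : E × G => (Module.finBasis ℝ E).repr (w.1 - x) i)
        (coordFst i) (x, y) := by
      simpa [coordFst] using ((coordFst (G := G) i).hasFDerivAt (x := (x, y))).sub_const
        (coordFst i (x, y))
    have a2 : HasFDerivAt (fun w : E × G => ψ i w.2)
        ((fderiv ℝ (ψ i) y).comp (ContinuousLinearMap.snd ℝ E G)) (x, y) :=
      HasFDerivAt.comp (x, y) ((ψ i).hasFDerivAt y) hasFDerivAt_snd
    have := a1.fun_smul a2
    refine this.congr_fderiv ?_
    simp
  have hsum := (hRd.fun_add hφd).fun_add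
    (HasFDerivAt.fun_sum (u := Finset.univ) fun i _ => hψd i)
  rw [← e] at hsum
  refine hsum.congr_fderiv ?_
  rw [zero_add, add_comm]
  congr 1
  ext v
  · simp [coordSnd]
  · have hv : fderiv ℝ φ y v = ∑ i, (Module.finBasis ℝ G).repr v i •
        fderiv ℝ φ y (Module.finBasis ℝ G i) := by
      conv_lhs => rw [← (Module.finBasis ℝ G).sum_repr v]
      rw [map_sum]
      simp only [map_smul]
    simp only [ContinuousLinearMap.comp_apply, ContinuousLinearMap.inr_apply,
      ContinuousLinearMap.coe_snd', hv, _root_.sum_apply]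
    simp [coordSnd, idTensorFun, lineDerivOp_apply_eq_fderiv, hφ]

theorem contDiff_idTensorFun (n : ℕ) : ∀ (L : 𝓢(F, ℂ) →L[ℂ] 𝓢(G, ℂ)) (Ψ : 𝓢(E × F, ℂ)),
    ContDiff ℝ n (idTensorFun (E := E) L Ψ) := by
  induction n with
  | zero =>
    intro L Ψ
    exact contDiff_zero.2 (Differentiable.continuous (𝕜 := ℝ)
      fun z => (hasFDerivAt_idTensorFun L Ψ z).differentiableAt)
  | succ n ih =>
    intro L Ψ
    refine (contDiff_succ_iff_fderiv (n := n)).2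
      ⟨fun z => (hasFDerivAt_idTensorFun L Ψ z).differentiableAt, by simp, ?_⟩
    have e : fderiv ℝ (idTensorFun (E := E) L Ψ) = fun z => _ :=
      funext fun z => (hasFDerivAt_idTensorFun L Ψ z).fderiv
    rw [e]
    refine ContDiff.add (ContDiff.sum fun i _ => ?_) (ContDiff.sum fun i _ => ?_)
    · exact contDiff_const.smulRight (ih _ _)
    · exact contDiff_const.smulRight (ih _ _)

theorem sum_seminorm_bound {X Y ι : Type*} [NormedAddCommGroup X] [NormedSpace ℝ X]
    (t : Finset ι) (a : ι → 𝓢(X, ℂ) → Y → ℝ)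
    (h : ∀ i, ∃ (s : Finset (ℕ × ℕ)) (C : ℝ), 0 ≤ C ∧ ∀ (Ψ : 𝓢(X, ℂ)) (z : Y),
      a i Ψ z ≤ C * s.sup (schwartzSeminormFamily ℂ X ℂ) Ψ) :
    ∃ (s : Finset (ℕ × ℕ)) (C : ℝ), 0 ≤ C ∧ ∀ (Ψ : 𝓢(X, ℂ)) (z : Y),
      ∑ i ∈ t, a i Ψ z ≤ C * s.sup (schwartzSeminormFamily ℂ X ℂ) Ψ := by
  choose s C hC h using h
  refine ⟨t.biUnion s, ∑ i ∈ t, C i, Finset.sum_nonneg fun i _ => hC i, fun Ψ z => ?_⟩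
  rw [Finset.sum_mul]
  refine Finset.sum_le_sum fun i hi => (h i Ψ z).trans ?_
  refine mul_le_mul_of_nonneg_left ?_ (hC i)
  exact Finset.sup_mono (f := schwartzSeminormFamily ℂ X ℂ)
    (Finset.subset_biUnion_of_mem s hi) Ψ

theorem iteratedFDeriv_idTensorFun_bound (n k : ℕ) : ∀ (L : 𝓢(F, ℂ) →L[ℂ] 𝓢(G, ℂ)),
    ∃ (s : Finset (ℕ × ℕ)) (C : ℝ), 0 ≤ C ∧ ∀ (Ψ : 𝓢(E × F, ℂ)) (z : E × G),
      ‖z‖ ^ k * ‖iteratedFDeriv ℝ n (idTensorFun L Ψ) z‖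
        ≤ C * s.sup (schwartzSeminormFamily ℂ (E × F) ℂ) Ψ := by
  induction n with
  | zero =>
    intro L
    simpa only [norm_iteratedFDeriv_zero] using idTensorFun_bound L k
  | succ n ih =>
    intro L
    let A : Fin (Module.finrank ℝ E) → 𝓢(E × F, ℂ) → E × G → ℂ := fun i Ψ =>
      idTensorFun L (∂_{((Module.finBasis ℝ E i, 0) : E × F)} Ψ : 𝓢(E × F, ℂ))
    let B : Fin (Module.finrank ℝ G) → 𝓢(E × F, ℂ) → E × G → ℂ := fun i Ψ =>
      idTensorFun ((lineDerivOpCLM ℂ 𝓢(G, ℂ) (Module.finBasis ℝ G i)).comp L) Ψ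
    have hA : ∀ i, ∃ (s : Finset (ℕ × ℕ)) (C : ℝ), 0 ≤ C ∧ ∀ (Ψ : 𝓢(E × F, ℂ)) (z : E × G),
        ‖ContinuousLinearMap.smulRightL ℝ (E × G) ℂ (coordFst i)‖ *
          (‖z‖ ^ k * ‖iteratedFDeriv ℝ n (A i Ψ) z‖)
          ≤ C * s.sup (schwartzSeminormFamily ℂ (E × F) ℂ) Ψ := by
      intro i
      obtain ⟨s, C, hC, h⟩ := ih L
      have hcont : Continuous fun Ψ => (s.sup (schwartzSeminormFamily ℂ (E × F) ℂ)) Ψ :=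
        Seminorm.continuous_finsetSup fun i _ =>
          (schwartz_withSeminorms ℂ (E × F) ℂ).continuous_seminorm i
      let D := lineDerivOpCLM ℂ 𝓢(E × F, ℂ) ((Module.finBasis ℝ E i, 0) : E × F)
      obtain ⟨s', C', -, h'⟩ := Seminorm.bound_of_continuous (schwartz_withSeminorms ℂ (E × F) ℂ)
        ((s.sup (schwartzSeminormFamily ℂ (E × F) ℂ)).comp D.toLinearMap)
        (hcont.comp D.continuous)
      refine ⟨s', ‖ContinuousLinearMap.smulRightL ℝ (E × G) ℂ (coordFst i)‖ * (C * C'),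
        by positivity, fun Ψ z => ?_⟩
      rw [mul_assoc]
      refine mul_le_mul_of_nonneg_left ((h _ z).trans ?_) (by positivity)
      rw [mul_assoc]
      exact mul_le_mul_of_nonneg_left (h' Ψ) hC
    have hB : ∀ i, ∃ (s : Finset (ℕ × ℕ)) (C : ℝ), 0 ≤ C ∧ ∀ (Ψ : 𝓢(E × F, ℂ)) (z : E × G),
        ‖ContinuousLinearMap.smulRightL ℝ (E × G) ℂ (coordSnd i)‖ *
          (‖z‖ ^ k * ‖iteratedFDeriv ℝ n (B i Ψ) z‖)
          ≤ C * s.sup (schwartzSeminormFamily ℂ (E × F) ℂ) Ψ := by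
      intro i
      obtain ⟨s, C, hC, h⟩ := ih ((lineDerivOpCLM ℂ 𝓢(G, ℂ) (Module.finBasis ℝ G i)).comp L)
      refine ⟨s, ‖ContinuousLinearMap.smulRightL ℝ (E × G) ℂ (coordSnd i)‖ * C,
        by positivity, fun Ψ z => ?_⟩
      rw [mul_assoc]
      exact mul_le_mul_of_nonneg_left (h Ψ z) (by positivity)
    obtain ⟨s, C, hC, h⟩ := sum_seminorm_bound Finset.univ
      (fun j : Fin (Module.finrank ℝ E) ⊕ Fin (Module.finrank ℝ G) => fun Ψ z => Sum.elim
        (fun i => ‖ContinuousLinearMap.smulRightL ℝ (E × G) ℂ (coordFst i)‖ *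
          (‖z‖ ^ k * ‖iteratedFDeriv ℝ n (A i Ψ) z‖))
        (fun i => ‖ContinuousLinearMap.smulRightL ℝ (E × G) ℂ (coordSnd i)‖ *
          (‖z‖ ^ k * ‖iteratedFDeriv ℝ n (B i Ψ) z‖)) j)
      (fun j => by rcases j with i | i; exacts [hA i, hB i])
    refine ⟨s, C, hC, fun Ψ z => le_trans ?_ (h Ψ z)⟩
    have cA : ∀ i, ContDiff ℝ n (A i Ψ) := fun i => contDiff_idTensorFun n _ _
    have cB : ∀ i, ContDiff ℝ n (B i Ψ) := fun i => contDiff_idTensorFun n _ _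
    have e : fderiv ℝ (idTensorFun (E := E) L Ψ) = fun z =>
        ∑ j : Fin (Module.finrank ℝ E) ⊕ Fin (Module.finrank ℝ G), Sum.elim
          (fun i => (ContinuousLinearMap.smulRightL ℝ (E × G) ℂ (coordFst i) ∘ A i Ψ) z)
          (fun i => (ContinuousLinearMap.smulRightL ℝ (E × G) ℂ (coordSnd i) ∘ B i Ψ) z) j := by
      funext z
      rw [(hasFDerivAt_idTensorFun L Ψ z).fderiv, Fintype.sum_sum_type]
      rfl
    rw [← norm_iteratedFDeriv_fderiv, e, iteratedFDeriv_fun_sum_apply]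
    · have hk : 0 ≤ ‖z‖ ^ k := by positivity
      refine (mul_le_mul_of_nonneg_left (norm_sum_le _ _) hk).trans ?_
      rw [Fintype.sum_sum_type]
      rw [Fintype.sum_sum_type, mul_add, Finset.mul_sum, Finset.mul_sum]
      refine add_le_add (Finset.sum_le_sum fun i _ => ?_) (Finset.sum_le_sum fun i _ => ?_)
      · simp only [Sum.elim_inl]
        rw [mul_left_comm]
        exact mul_le_mul_of_nonneg_left (ContinuousLinearMap.norm_iteratedFDeriv_comp_left _
          (cA i).contDiffAt le_rfl) (by positivity)
      · simp only [Sum.elim_inr]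
        rw [mul_left_comm]
        exact mul_le_mul_of_nonneg_left (ContinuousLinearMap.norm_iteratedFDeriv_comp_left _
          (cB i).contDiffAt le_rfl) (by positivity)
    · rintro (i | i) -
      · exact ((ContinuousLinearMap.contDiff _).comp (cA i)).contDiffAt
      · exact ((ContinuousLinearMap.contDiff _).comp (cB i)).contDiffAt

/-- The operator `id ⊗ L`, i.e. `Ψ ↦ ((x, y) ↦ L (Ψ(x, ·)) (y))`. -/
def idTensorCLM (L : 𝓢(F, ℂ) →L[ℂ] 𝓢(G, ℂ)) : 𝓢(E × F, ℂ) →L[ℂ] 𝓢(E × G, ℂ) :=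
  mkCLM (idTensorFun L) (fun _ _ _ => by simp [idTensorFun]) (fun _ _ _ => by simp [idTensorFun])
    (fun Ψ => contDiff_infty.2 fun n => contDiff_idTensorFun n L Ψ)
    (fun i => iteratedFDeriv_idTensorFun_bound i.2 i.1 L)

@[simp]
theorem idTensorCLM_apply (L : 𝓢(F, ℂ) →L[ℂ] 𝓢(G, ℂ)) (Ψ : 𝓢(E × F, ℂ)) (x : E) (y : G) :
    idTensorCLM L Ψ (x, y) = L (sliceCLM x Ψ) y := rfl

/-- The constant functions on a point, as Schwartz functions. -/
def constPoint : ℂ →L[ℂ] 𝓢(PUnit.{1}, ℂ) :=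
  LinearMap.toContinuousLinearMap
    { toFun := fun c =>
        { toFun := fun _ => c
          smooth' := contDiff_const
          decay' := fun k n => ⟨‖(0 : PUnit.{1})‖ ^ k * ‖iteratedFDeriv ℝ n (fun _ : PUnit.{1} => c) 0‖,
            fun x => by rw [Subsingleton.elim x 0]⟩ }
      map_add' := fun _ _ => rfl
      map_smul' := fun _ _ => rfl }

/-- The partial action of a distribution `h` on the second variable: `Ψ ↦ (x ↦ h(Ψ(x, ·)))`. -/
def contractSnd (h : 𝓢'(F, ℂ)) : 𝓢(E × F, ℂ) →L[ℂ] 𝓢(E, ℂ) :=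
  (compCLMOfContinuousLinearEquiv ℂ (ContinuousLinearEquiv.prodUnique ℝ E PUnit.{1}).symm).comp
    (idTensorCLM (constPoint.comp
      (⟨h.toLinearMap, h.continuous⟩ : 𝓢(F, ℂ) →L[ℂ] ℂ)))

@[simp]
theorem contractSnd_apply (h : 𝓢'(F, ℂ)) (Ψ : 𝓢(E × F, ℂ)) (x : E) :
    contractSnd h Ψ x = h (sliceCLM x Ψ) := rfl

/-- The tensor product of two tempered distributions, `(f ⊗ h)(Ψ) = f(x ↦ h(Ψ(x, ·)))`. -/
def tensorDistrib (f : 𝓢'(E, ℂ)) (h : 𝓢'(F, ℂ)) : 𝓢'(E × F, ℂ) :=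
  ContinuousLinearMap.toPointwiseConvergenceCLM _ _ _ _
    ((⟨f.toLinearMap, f.continuous⟩ : 𝓢(E, ℂ) →L[ℂ] ℂ).comp (contractSnd h))

@[simp]
theorem tensorDistrib_apply (f : 𝓢'(E, ℂ)) (h : 𝓢'(F, ℂ)) (Ψ : 𝓢(E × F, ℂ)) :
    tensorDistrib f h Ψ = f (contractSnd h Ψ) := rfl

end Tensor

section Conj

variable {V : Type*} [NormedAddCommGroup V] [NormedSpace ℝ V]

/-- Complex conjugation of Schwartz functions. -/
def conjSchwartz : 𝓢(V, ℂ) →L[ℝ] 𝓢(V, ℂ) :=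
  postcompCLM (Complex.conjCLE : ℂ →L[ℝ] ℂ)

@[simp]
theorem conjSchwartz_apply (φ : 𝓢(V, ℂ)) (x : V) :
    conjSchwartz φ x = starRingEnd ℂ (φ x) := rfl

/-- The complex conjugate of a tempered distribution. -/
def conjDistrib (f : 𝓢'(V, ℂ)) : 𝓢'(V, ℂ) :=
  ContinuousLinearMap.toPointwiseConvergenceCLM _ _ _ _
    { toFun := fun φ => starRingEnd ℂ (f (conjSchwartz φ))
      map_add' := fun φ ψ => by simp
      map_smul' := fun c φ => by
        have : conjSchwartz (c • φ) = starRingEnd ℂ c • conjSchwartz φ := by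
          ext x; simp
        simp [this]
      cont := Complex.continuous_conj.comp (f.continuous.comp conjSchwartz.continuous) }

@[simp]
theorem conjDistrib_apply (f : 𝓢'(V, ℂ)) (φ : 𝓢(V, ℂ)) :
    conjDistrib f φ = starRingEnd ℂ (f (conjSchwartz φ)) := rfl

end Conj

section STFT

variable {V : Type*} [NormedAddCommGroup V] [InnerProductSpace ℝ V]

/-- The character `t ↦ exp(2πi ξ·t)`. -/
def character (ξ t : V) : ℂ := Complex.exp (2 * Real.pi * Complex.I * (inner ℝ ξ t : ℝ))

theorem hasTemperateGrowth_character (ξ : V) : (character ξ).HasTemperateGrowth := by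
  have h1 : Function.HasTemperateGrowth
      (fun t : ℝ => Complex.exp (2 * Real.pi * Complex.I * (t : ℂ))) := by
    have hd : ∀ n : ℕ, iteratedDeriv n
        (fun t : ℝ => Complex.exp (2 * Real.pi * Complex.I * (t : ℂ))) = fun t : ℝ =>
          (2 * Real.pi * Complex.I) ^ n * Complex.exp (2 * Real.pi * Complex.I * (t : ℂ)) := by
      intro n
      induction n with
      | zero => simp
      | succ n ih =>
        rw [iteratedDeriv_succ, ih]
        ext t
        have h2 : HasDerivAt (fun t : ℝ => 2 * Real.pi * Complex.I * (t : ℂ))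
            (2 * Real.pi * Complex.I) t := by
          simpa using (Complex.ofRealCLM.hasDerivAt (x := t)).const_mul (2 * Real.pi * Complex.I)
        rw [(h2.cexp.const_mul _).deriv]
        ring
    refine ⟨?_, fun n => ⟨0, (2 * Real.pi) ^ n, fun x => ?_⟩⟩
    · exact Complex.contDiff_exp.comp (contDiff_const.mul Complex.ofRealCLM.contDiff)
    · rw [norm_iteratedFDeriv_eq_norm_iteratedDeriv, hd]
      have : ‖Complex.exp (2 * Real.pi * Complex.I * (x : ℂ))‖ = 1 := by
        rw [show (2 * Real.pi * Complex.I * (x : ℂ)) = ((2 * Real.pi * x : ℝ) : ℂ) * Complex.I by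
          push_cast; ring, Complex.norm_exp_ofReal_mul_I]
      simp [this, abs_of_pos Real.pi_pos]
  exact h1.comp (Function.hasTemperateGrowth_inner_right ξ)

/-- The time-frequency shift `M_ξ T_x g`, i.e. `t ↦ exp(2πi ξ·t) g(t - x)`. -/
def timeFreqShift (x ξ : V) (g : 𝓢(V, ℂ)) : 𝓢(V, ℂ) :=
  smulLeftCLM ℂ (character ξ) (compSubConstCLM ℂ x g)

@[simp]
theorem timeFreqShift_apply (x ξ : V) (g : 𝓢(V, ℂ)) (t : V) :
    timeFreqShift x ξ g t = character ξ t * g (t - x) := by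
  simp [timeFreqShift, smulLeftCLM_apply_apply (hasTemperateGrowth_character ξ)]

/-- The short-time Fourier transform `V_g f(x, ξ) = ⟨f, M_ξ T_x g⟩` (the pairing being conjugate
linear in the second slot), formally `∫ f(t) conj(g(t - x)) exp(-2πi ξ·t) dt`. -/
def stft (g : 𝓢(V, ℂ)) (f : 𝓢'(V, ℂ)) (x ξ : V) : ℂ :=
  f (conjSchwartz (timeFreqShift x ξ g))

variable [FiniteDimensional ℝ V] [MeasurableSpace V] [BorelSpace V]

/-- The weighted mixed norm of `L^{p,q}_m`: the `L^p` norm in `x`, then the `L^q` norm in `ξ`. -/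
def mixedNorm (p q : ℝ≥0∞) (m : V → V → ℝ) (F : V → V → ℂ) : ℝ≥0∞ :=
  eLpNorm (fun ξ => eLpNorm (fun x => F x ξ * (m x ξ : ℂ)) p volume) q volume

/-- The norm of `M^{p,q}_m`, computed with the window `g`; it is `∞` outside of the space. -/
def modulationNorm (g : 𝓢(V, ℂ)) (p q : ℝ≥0∞) (m : V → V → ℝ) (f : 𝓢'(V, ℂ)) : ℝ≥0∞ :=
  mixedNorm p q m (stft g f)

/-- The modulation space `M^{p,q}_m`, described with the window `g`. The function `stft g f` is
continuous for every tempered distribution `f`, so that membership is finiteness of the norm. -/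
def modulationSpace (g : 𝓢(V, ℂ)) (p q : ℝ≥0∞) (m : V → V → ℝ) : Set 𝓢'(V, ℂ) :=
  {f | modulationNorm g p q m f < ⊤}

end STFT

section Weights

variable {V : Type*} [NormedAddCommGroup V] [InnerProductSpace ℝ V]

/-- `⟨z⟩^s = (1 + |z|²)^{s/2}`. -/
def japaneseBracket (s : ℝ) (z : V) : ℝ := (1 + ‖z‖ ^ 2) ^ (s / 2)

/-- The constant weight `1`. -/
def oneWeight (_ _ : V) : ℝ := 1

/-- The weight `v_s(x, ξ) = (1 + |x|² + |ξ|²)^{s/2}`. -/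
def vWeight (s : ℝ) (x ξ : V) : ℝ := japaneseBracket s (WithLp.toLp 2 (x, ξ))

/-- The weight `(1 ⊗ v_s)(z, ζ) = v_s(ζ)`. -/
def oneTensorWeight (s : ℝ) (_ ζ : V) : ℝ := japaneseBracket s ζ

end Weights

section Wigner

variable {E : Type*} [NormedAddCommGroup E] [InnerProductSpace ℝ E]

/-- The linear change of variables `(u, v) ↦ ((u + v)/2, u - v)`, with inverse
`(x, t) ↦ (x + t/2, x - t/2)`. -/
def wignerCoord : (E × E) ≃L[ℝ] (E × E) :=
  ContinuousLinearEquiv.equivOfInverse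
    (((2⁻¹ : ℝ) • (ContinuousLinearMap.fst ℝ E E + ContinuousLinearMap.snd ℝ E E)).prod
      (ContinuousLinearMap.fst ℝ E E - ContinuousLinearMap.snd ℝ E E))
    ((ContinuousLinearMap.fst ℝ E E + (2⁻¹ : ℝ) • ContinuousLinearMap.snd ℝ E E).prod
      (ContinuousLinearMap.fst ℝ E E - (2⁻¹ : ℝ) • ContinuousLinearMap.snd ℝ E E))
    (fun z => by ext <;> simp <;> module)
    (fun z => by ext <;> simp <;> module)

@[simp]
theorem wignerCoord_apply (u v : E) : wignerCoord (u, v) = ((2⁻¹ : ℝ) • (u + v), u - v) := rfl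

variable [FiniteDimensional ℝ E] [MeasurableSpace E] [BorelSpace E]

/-- The partial Fourier transform in the second variable,
`(x, t) ↦ ∫ Ψ(x, ξ) exp(-2πi ξ·t) dξ`. -/
def partialFourier : 𝓢(E × E, ℂ) →L[ℂ] 𝓢(E × E, ℂ) :=
  idTensorCLM (fourierTransformCLM ℂ)

theorem partialFourier_apply (Ψ : 𝓢(E × E, ℂ)) (x t : E) :
    partialFourier Ψ (x, t)
      = ∫ ξ, Complex.exp (-2 * Real.pi * Complex.I * (inner ℝ ξ t : ℝ)) * Ψ (x, ξ) := by
  change 𝓕 (sliceCLM x Ψ : E → ℂ) t = _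
  rw [Real.fourier_eq']
  refine integral_congr_ae (Filter.Eventually.of_forall fun ξ => ?_)
  simp only [sliceCLM_apply, smul_eq_mul]
  congr 2
  push_cast
  ring

/-- The operator on test functions transposed to `f₁ ⊗ conj f₂ ↦ W(f₁, f₂)`:
`Ψ ↦ ((u, v) ↦ ∫ Ψ((u + v)/2, ξ) exp(-2πi ξ·(u - v)) dξ)`. -/
def wignerTranspose : 𝓢(WithLp 2 (E × E), ℂ) →L[ℂ] 𝓢(E × E, ℂ) :=
  (compCLMOfContinuousLinearEquiv ℂ wignerCoord).comp
    (partialFourier.comp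
      (compCLMOfContinuousLinearEquiv ℂ (WithLp.prodContinuousLinearEquiv 2 ℝ E E).symm))

theorem wignerTranspose_apply (Ψ : 𝓢(WithLp 2 (E × E), ℂ)) (u v : E) :
    wignerTranspose Ψ (u, v)
      = ∫ ξ, Complex.exp (-2 * Real.pi * Complex.I * (inner ℝ ξ (u - v) : ℝ)) *
        Ψ (WithLp.toLp 2 ((2⁻¹ : ℝ) • (u + v), ξ)) :=
  partialFourier_apply _ _ _

/-- The cross-Wigner distribution of two tempered distributions: the extension to
`𝓢' × 𝓢' → 𝓢'` of `W(f₁, f₂)(x, ξ) = ∫ f₁(x + t/2) conj(f₂(x - t/2)) exp(-2πi ξ·t) dt`.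
Testing this function against `Ψ` and substituting `u = x + t/2`, `v = x - t/2` gives
`∬ f₁(u) conj(f₂(v)) (wignerTranspose Ψ)(u, v) du dv`. -/
def crossWigner (f₁ f₂ : 𝓢'(E, ℂ)) : 𝓢'(WithLp 2 (E × E), ℂ) :=
  ContinuousLinearMap.toPointwiseConvergenceCLM _ _ _ _
    ((⟨(tensorDistrib f₁ (conjDistrib f₂)).toLinearMap,
      (tensorDistrib f₁ (conjDistrib f₂)).continuous⟩ : 𝓢(E × E, ℂ) →L[ℂ] ℂ).comp wignerTranspose)

theorem crossWigner_apply (f₁ f₂ : 𝓢'(E, ℂ)) (Ψ : 𝓢(WithLp 2 (E × E), ℂ)) :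
    crossWigner f₁ f₂ Ψ = tensorDistrib f₁ (conjDistrib f₂) (wignerTranspose Ψ) := rfl

end Wigner

end TimeFreq

end

noncomputable section

namespace TimeFreq

open SchwartzMap LineDeriv MeasureTheory
open scoped FourierTransform

/-! ### Mixed Lebesgue norms: measurability, Minkowski, Hölder. -/

section MixedNorms

variable {α β : Type*} [MeasurableSpace α] [MeasurableSpace β] {μ : Measure α} {ν : Measure β}

/-! With the window `W(g, g)`, the short-time Fourier transform of a cross-Wigner distribution
factors (`stft_crossWigner`): up to a phase, its value at `(z, ζ)` is `V_g f₁(a)` times the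
conjugate of `V_g f₂(b)`, where `a = (z₁ - ζ₂/2, z₂ + ζ₁/2)` and `b = (z₁ + ζ₂/2, z₂ - ζ₁/2)`.

Since `a - b = (-ζ₂, ζ₁)` has the length of `ζ`, the weight obeys `v_s(ζ) ≤ 2^s (v_s(a) + v_s(b))`
(`japaneseBracket_le_vWeight_add`). This puts the weight on one factor at a time and produces the
two terms of the bound.

For fixed `ζ` and finite `p`, the `p`-th power of the `L^p` norm in `z` is a correlation of `|V_g
f₁|^p` and `|V_g f₂|^p` (with their weights) evaluated at `(ζ₂, ζ₁)` up to signs. Young's inequality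
in mixed norms, with exponents `p_i/p`, `q_i/p` and target `q/p`, bounds the `L^q` norm in `ζ`
(`eLpNorm_eLpNorm_wigner_le`). It needs `p ≤ p_i, q_i` and equality in both exponent relations.

The general case reduces to this one because modulation spaces grow with their exponents: `p` is
lowered to `min p q`, and `exists_exponents` raises the exponents of `f₁` and `f₂` until the
relations are equalities.

Both the inclusions and the passage from `W(g, g)` to an arbitrary window come from
`exists_modulationNorm_le`. The inversion formula `integral_stftSchwartz_mul_stft` dominates a
transform with one window by the convolution of a transform with another window and a Schwartz
function, and Young's inequality applies again. For tempered distributions this formula rests on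
interchanging a distribution with an integral of Schwartz functions (`distrib_integral_eq`), which
is obtained by extending the distribution to a Banach space of weighted jets, where the Bochner
integral is available. -/

theorem eLpNorm_rpow_toReal_eq_lintegral {p : ℝ≥0∞} (h0 : p ≠ 0) (ht : p ≠ ∞) (f : α → ℝ≥0∞) :
    eLpNorm f p μ ^ p.toReal = ∫⁻ x, f x ^ p.toReal ∂μ := by
  rw [eLpNorm_eq_lintegral_rpow_enorm_toReal h0 ht, ← ENNReal.rpow_mul, one_div,
    inv_mul_cancel₀ (ENNReal.toReal_pos h0 ht).ne', ENNReal.rpow_one]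
  simp

/-- For finite exponents this is Tonelli. For `p = ∞` the norm exceeds `c` exactly when the section
of `{f > c}` has positive measure, and the measure of a section depends measurably on `y`. -/
theorem measurable_eLpNorm_left [SFinite μ] {f : α → β → ℝ≥0∞}
    (hf : Measurable (Function.uncurry f)) (p : ℝ≥0∞) :
    Measurable fun y => eLpNorm (fun x => f x y) p μ := by
  rcases eq_or_ne p 0 with rfl | h0
  · simp
  rcases eq_or_ne p ∞ with rfl | ht
  · refine measurable_of_Ioi fun c => ?_
    have : ((fun y => eLpNorm (fun x => f x y) ∞ μ) ⁻¹' Set.Ioi c)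
        = {y | μ {x | c < f x y} = 0}ᶜ := by
      ext y
      simp only [Set.mem_preimage, Set.mem_Ioi, Set.mem_compl_iff, Set.mem_ofPred_eq,
        eLpNorm_exponent_top, eLpNormEssSup_eq_essSup_enorm, enorm_eq_self]
      rw [← not_le, not_iff_not]
      constructor
      · intro h
        have := ae_le_essSup (μ := μ) (f := fun x => f x y)
        refine measure_mono_null (fun x hx => ?_) this
        simp only [Set.mem_compl_iff, Set.mem_ofPred_eq, not_le] at hx ⊢
        exact h.trans_lt hx
      · intro h
        refine essSup_le_of_ae_le c ?_
        refine measure_mono_null (fun x hx => ?_) h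
        simpa using hx
    rw [this]
    refine MeasurableSet.compl ?_
    have hs : MeasurableSet {z : α × β | c < f z.1 z.2} := measurableSet_lt measurable_const hf
    exact (measurable_measure_prodMk_right (μ := μ) hs) (measurableSet_singleton 0)
  · simp only [eLpNorm_eq_lintegral_rpow_enorm_toReal h0 ht, enorm_eq_self]
    refine Measurable.pow_const ?_ _
    exact Measurable.lintegral_prod_left' (f := fun z : α × β => f z.1 z.2 ^ p.toReal)
      (hf.pow_const _)

/-- Minkowski's integral inequality. -/
theorem eLpNorm_lintegral_le [SigmaFinite μ] [SFinite ν] {f : α → β → ℝ≥0∞}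
    (hf : Measurable (Function.uncurry f)) {r : ℝ≥0∞} (hr : 1 ≤ r) :
    eLpNorm (fun x => ∫⁻ y, f x y ∂ν) r μ ≤ ∫⁻ y, eLpNorm (fun x => f x y) r μ ∂ν := by
  have hm := measurable_eLpNorm_left (μ := μ) hf r
  have hr0 : r ≠ 0 := (zero_lt_one.trans_le hr).ne'
  have hH : Measurable fun x => ∫⁻ y, f x y ∂ν := Measurable.lintegral_prod_right' hf
  rcases eq_or_ne r ∞ with rfl | ht
  · rw [eLpNorm_exponent_top, eLpNormEssSup_eq_essSup_enorm]
    refine essSup_le_of_ae_le _ ?_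
    have h1 : ∀ᵐ y ∂ν, ∀ᵐ x ∂μ, f x y ≤ eLpNorm (fun x => f x y) ∞ μ := by
      refine Filter.Eventually.of_forall fun y => ?_
      simpa [eLpNormEssSup_eq_essSup_enorm] using ae_le_essSup (μ := μ) (f := fun x => f x y)
    have hs : MeasurableSet {z : α × β | f z.1 z.2 ≤ eLpNorm (fun x => f x z.2) ∞ μ} :=
      measurableSet_le hf (hm.comp measurable_snd)
    -- The null set of bad `x` depends on `y`; Fubini for null sets exchanges the two quantifiers.
    have h2 := (Measure.ae_ae_comm (μ := μ) (ν := ν)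
      (p := fun x y => f x y ≤ eLpNorm (fun x => f x y) ∞ μ) hs).2 h1
    filter_upwards [h2] with x hx
    simp only [enorm_eq_self]
    exact lintegral_mono_ae hx
  set p := r.toReal with hp
  have hp1 : 1 ≤ p := by
    rw [hp, ← ENNReal.toReal_one]; exact (ENNReal.toReal_le_toReal (by simp) ht).2 hr
  have hp0 : 0 < p := by linarith
  rcases hp1.eq_or_lt with hp1 | hp1
  · have : r = 1 := by
      rw [← ENNReal.ofReal_toReal ht, ← hp, ← hp1]; simp
    subst this
    simp only [eLpNorm_one_eq_lintegral_enorm, enorm_eq_self]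
    exact (lintegral_lintegral_swap hf.aemeasurable).le
  set A := ∫⁻ y, eLpNorm (fun x => f x y) r μ ∂ν with hA
  obtain ⟨q, hpq⟩ : ∃ q, p.HolderConjugate q := ⟨_, Real.HolderConjugate.conjExponent hp1⟩
  have key : ∫⁻ x, (∫⁻ y, f x y ∂ν) ^ p ∂μ ≤ A ^ p := by
    -- Duality would divide by a power of `∫ H^p`, with `H` the inner integral, and this may be
    -- infinite. If the bound failed, some simple function `g ≤ H^p` would satisfy `A^p < ∫ g < ∞`,
    -- and the division can be carried out with `∫ g`.
    by_contra! hlt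
    rw [lintegral_eq_nnreal] at hlt
    simp_rw [lt_iSup_iff] at hlt
    obtain ⟨g₀, hg₀, hlt⟩ := hlt
    have h'L : A ^ p < ∫⁻ x, g₀ x ∂μ := by
      convert hlt
      rw [← SimpleFunc.lintegral_eq_lintegral, SimpleFunc.coe_map]
      simp only [Function.comp_apply]
    obtain ⟨g, hg, gL, gtop⟩ := SimpleFunc.exists_lt_lintegral_simpleFunc_of_lt_lintegral h'L
    have hgH : ∀ x, (g x : ℝ≥0∞) ≤ (∫⁻ y, f x y ∂ν) ^ p := fun x =>
      (ENNReal.coe_le_coe.2 (hg x)).trans (hg₀ x)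
    have hgm : Measurable fun x => (g x : ℝ≥0∞) := g.measurable.coe_nnreal_ennreal
    have hq0 : 0 < q := hpq.symm.pos
    have hsum : q⁻¹ + p⁻¹ = 1 := hpq.symm.inv_add_inv_eq_one
    set I := ∫⁻ x, (g x : ℝ≥0∞) ∂μ with hI
    -- Write `g = g^{1/p} g^{1/q}`, bound the first factor by `H`, exchange the integrals and apply
    -- Hölder in `x`; the `L^q` norm of `g^{1/q}` is `I^{1/q}`.
    have h1 : I ≤ A * I ^ q⁻¹ := by
      calc I ≤ ∫⁻ x, ∫⁻ y, f x y * (g x : ℝ≥0∞) ^ q⁻¹ ∂ν ∂μ := by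
            refine lintegral_mono fun x => ?_
            rw [lintegral_mul_const _ (show Measurable (f x) from hf.comp measurable_prodMk_left)]
            calc (g x : ℝ≥0∞) = (g x : ℝ≥0∞) ^ p⁻¹ * (g x : ℝ≥0∞) ^ q⁻¹ := by
                  rw [← ENNReal.rpow_add_of_nonneg _ _ (by positivity) (by positivity),
                    add_comm, hsum, ENNReal.rpow_one]
              _ ≤ _ := by
                  gcongr
                  calc (g x : ℝ≥0∞) ^ p⁻¹ ≤ ((∫⁻ y, f x y ∂ν) ^ p) ^ p⁻¹ := by
                        gcongr; exact hgH x
                    _ = _ := by rw [← ENNReal.rpow_mul, mul_inv_cancel₀ hp0.ne', ENNReal.rpow_one]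
        _ = ∫⁻ y, ∫⁻ x, f x y * (g x : ℝ≥0∞) ^ q⁻¹ ∂μ ∂ν :=
            lintegral_lintegral_swap
              (hf.mul ((hgm.comp measurable_fst).pow_const _)).aemeasurable
        _ ≤ ∫⁻ y, eLpNorm (fun x => f x y) r μ * I ^ q⁻¹ ∂ν := by
            refine lintegral_mono fun y => ?_
            refine (ENNReal.lintegral_mul_le_Lp_mul_Lq μ hpq
              (hf.comp measurable_prodMk_right).aemeasurable (hgm.pow_const _).aemeasurable).trans ?_
            rw [eLpNorm_eq_lintegral_rpow_enorm_toReal hr0 ht]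
            simp only [enorm_eq_self, one_div, ← ENNReal.rpow_mul, inv_mul_cancel₀ hq0.ne',
              ENNReal.rpow_one]
            exact le_rfl
        _ = A * I ^ q⁻¹ := lintegral_mul_const _ hm
    have hI0 : I ≠ 0 := (bot_le.trans_lt gtop).ne'
    have h2 : I ^ p⁻¹ ≤ A := by
      have e : I = I ^ p⁻¹ * I ^ q⁻¹ := by
        rw [← ENNReal.rpow_add_of_nonneg _ _ (by positivity) (by positivity),
          add_comm, hsum, ENNReal.rpow_one]
      have z : I ^ q⁻¹ ≠ 0 := by simp [hI0, hq0]; exact fun h => absurd h gL.ne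
      have t : I ^ q⁻¹ ≠ ∞ := ENNReal.rpow_ne_top_of_nonneg (by positivity) gL.ne
      exact (ENNReal.mul_le_mul_iff_left z t).1 (e.symm.le.trans h1)
    have h3 : I ≤ A ^ p := by
      calc I = (I ^ p⁻¹) ^ p := by rw [← ENNReal.rpow_mul, inv_mul_cancel₀ hp0.ne', ENNReal.rpow_one]
        _ ≤ A ^ p := by gcongr
    exact absurd gtop h3.not_gt
  rw [eLpNorm_eq_lintegral_rpow_enorm_toReal hr0 ht]
  simp only [enorm_eq_self]
  calc _ ≤ (A ^ p) ^ (1 / p) := by gcongr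
    _ = A := by rw [← ENNReal.rpow_mul, mul_one_div_cancel hp0.ne', ENNReal.rpow_one]

/-- Hölder's inequality for conjugate exponents, in terms of `eLpNorm`. -/
theorem lintegral_mul_le_eLpNorm_mul_eLpNorm {p q : ℝ≥0∞} (hpq : p⁻¹ + q⁻¹ = 1)
    {f g : α → ℝ≥0∞} (hf : Measurable f) (hg : Measurable g) :
    ∫⁻ x, f x * g x ∂μ ≤ eLpNorm f p μ * eLpNorm g q μ := by
  have aux : ∀ {f g : α → ℝ≥0∞}, Measurable f → Measurable g →
      ∫⁻ x, f x * g x ∂μ ≤ eLpNorm f 1 μ * eLpNorm g ∞ μ := by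
    intro f g hf hg
    rw [eLpNorm_one_eq_lintegral_enorm, ← lintegral_mul_const _ hf.enorm]
    refine lintegral_mono_ae ?_
    have := ae_le_essSup (μ := μ) (f := g)
    filter_upwards [this] with x hx
    simp only [enorm_eq_self, eLpNorm_exponent_top, eLpNormEssSup_eq_essSup_enorm]
    gcongr
  rcases eq_or_ne p ∞ with rfl | hp
  · have : q = 1 := by simpa using hpq
    subst this
    simp_rw [mul_comm (f _), mul_comm (eLpNorm f _ _)]
    exact aux hg hf
  rcases eq_or_ne q ∞ with rfl | hq
  · have : p = 1 := by simpa using hpq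
    subst this
    exact aux hf hg
  have hp0 : p ≠ 0 := by rintro rfl; simp at hpq
  have hq0 : q ≠ 0 := by rintro rfl; simp at hpq
  have hc : p.toReal.HolderConjugate q.toReal := by
    refine ⟨?_, ENNReal.toReal_pos hp0 hp, ENNReal.toReal_pos hq0 hq⟩
    have := congrArg ENNReal.toReal hpq
    rw [ENNReal.toReal_add (by simpa using hp0) (by simpa using hq0)] at this
    simpa [ENNReal.toReal_inv] using this
  rw [eLpNorm_eq_lintegral_rpow_enorm_toReal hp0 hp, eLpNorm_eq_lintegral_rpow_enorm_toReal hq0 hq]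
  simpa using ENNReal.lintegral_mul_le_Lp_mul_Lq μ hc hf.aemeasurable hg.aemeasurable

end MixedNorms

/-! ### Young's inequality, plain and mixed. -/

section Young

variable {G H : Type*} [AddCommGroup G] [MeasurableSpace G] [MeasurableAdd₂ G] [MeasurableNeg G]
  {μ : Measure G} [μ.IsAddLeftInvariant] [μ.IsNegInvariant] [SigmaFinite μ]
  [AddCommGroup H] [MeasurableSpace H] [MeasurableAdd₂ H] [MeasurableNeg H]
  {ν : Measure H} [ν.IsAddLeftInvariant] [ν.IsNegInvariant] [SigmaFinite ν]

/-- Young's convolution inequality. -/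
theorem eLpNorm_convolution_le {p q r : ℝ≥0∞} (hp : 1 ≤ p) (hq : 1 ≤ q)
    (hpqr : p⁻¹ + q⁻¹ = 1 + r⁻¹) {f g : G → ℝ≥0∞} (hf : Measurable f) (hg : Measurable g) :
    eLpNorm (fun x => ∫⁻ y, f (x - y) * g y ∂μ) r μ ≤ eLpNorm f p μ * eLpNorm g q μ := by
  have hp' : p⁻¹ ≤ 1 := ENNReal.inv_le_one.2 hp
  have hq' : q⁻¹ ≤ 1 := ENNReal.inv_le_one.2 hq
  have hp0 : p ≠ 0 := (zero_lt_one.trans_le hp).ne'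
  have hq0 : q ≠ 0 := (zero_lt_one.trans_le hq).ne'
  rcases eq_or_ne r ∞ with rfl | hr
  · rw [eLpNorm_exponent_top, eLpNormEssSup_eq_essSup_enorm]
    refine essSup_le_of_ae_le _ (Filter.Eventually.of_forall fun x => ?_)
    simp only [enorm_eq_self]
    refine (lintegral_mul_le_eLpNorm_mul_eLpNorm (by simpa using hpqr)
      (hf.comp (measurable_const.sub measurable_id)) hg).trans_eq ?_
    congr 1
    exact eLpNorm_comp_measurePreserving (p := p) hf.aestronglyMeasurable
      (Measure.measurePreserving_sub_left μ x)
  have hr0 : r ≠ 0 := by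
    rintro rfl
    have : p⁻¹ + q⁻¹ < ∞ := ENNReal.add_lt_top.2
      ⟨hp'.trans_lt ENNReal.one_lt_top, hq'.trans_lt ENNReal.one_lt_top⟩
    simp [hpqr] at this
  have hrp : r⁻¹ ≤ p⁻¹ := by
    have : 1 + r⁻¹ ≤ 1 + p⁻¹ := by rw [← hpqr, add_comm]; gcongr
    exact (ENNReal.add_le_add_iff_left ENNReal.one_ne_top).1 this
  have hrq : r⁻¹ ≤ q⁻¹ := by
    have : 1 + r⁻¹ ≤ 1 + q⁻¹ := by rw [← hpqr]; gcongr
    exact (ENNReal.add_le_add_iff_left ENNReal.one_ne_top).1 this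
  have hpt : p ≠ ∞ := by rintro rfl; simp [hr] at hrp
  have hqt : q ≠ ∞ := by rintro rfl; simp [hr] at hrq
  set a := p.toReal with ha
  set b := q.toReal with hb
  set c := r.toReal with hc
  have ha0 : 0 < a := ENNReal.toReal_pos hp0 hpt
  have hb0 : 0 < b := ENNReal.toReal_pos hq0 hqt
  have hc0 : 0 < c := ENNReal.toReal_pos hr0 hr
  have hac : 0 ≤ a⁻¹ - c⁻¹ := by
    have := ENNReal.toReal_mono (by simpa using hp0) hrp
    simpa [ENNReal.toReal_inv] using this
  have hbc : 0 ≤ b⁻¹ - c⁻¹ := by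
    have := ENNReal.toReal_mono (by simpa using hq0) hrq
    simpa [ENNReal.toReal_inv] using this
  have habc : a⁻¹ + b⁻¹ = 1 + c⁻¹ := by
    have := congrArg ENNReal.toReal hpqr
    rw [ENNReal.toReal_add (by simpa using hp0) (by simpa using hq0),
      ENNReal.toReal_add (by simp) (by simpa using hr0)] at this
    simpa [ENNReal.toReal_inv] using this
  have hfa : Measurable fun x => f x ^ a := hf.pow_const _
  have hgb : Measurable fun x => g x ^ b := hg.pow_const _
  set A := ∫⁻ x, f x ^ a ∂μ with hA
  set B := ∫⁻ x, g x ^ b ∂μ with hB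
  have hK : Measurable fun z : G × G => f (z.1 - z.2) ^ a * g z.2 ^ b :=
    (hfa.comp (measurable_fst.sub measurable_snd)).mul (hgb.comp measurable_snd)
  have hpt' : ∀ x, ∫⁻ y, f (x - y) * g y ∂μ
      ≤ (∫⁻ y, f (x - y) ^ a * g y ^ b ∂μ) ^ c⁻¹ * (A ^ (a⁻¹ - c⁻¹) * B ^ (b⁻¹ - c⁻¹)) := by
    intro x
    have hfx : Measurable fun y => f (x - y) ^ a := hfa.comp (measurable_const.sub measurable_id)
    -- Hölder with three factors. The exponents `1/c`, `1/a - 1/c`, `1/b - 1/c` are nonnegative and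
    -- sum to `1` by the Young relation. Only the first factor stays under the integral in `y`; the
    -- other two integrate to `A` and `B`.
    have := ENNReal.lintegral_prod_norm_pow_le (μ := μ) (Finset.univ : Finset (Fin 3))
      (f := ![fun y => f (x - y) ^ a * g y ^ b, fun y => f (x - y) ^ a, fun y => g y ^ b])
      (p := ![c⁻¹, a⁻¹ - c⁻¹, b⁻¹ - c⁻¹])
      (by
        intro i _
        fin_cases i
        · exact (hfx.mul hgb).aemeasurable
        · exact hfx.aemeasurable
        · exact hgb.aemeasurable)
      (by simp [Fin.sum_univ_three]; linarith)
      (by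
        intro i _
        fin_cases i
        · simpa using hc0.le
        · simpa using hac
        · simpa using hbc)
    simp only [Fin.prod_univ_three, Matrix.cons_val_zero, Matrix.cons_val_one,
      Matrix.cons_val] at this
    rw [lintegral_sub_left_eq_self (fun y => f y ^ a) x] at this
    calc ∫⁻ y, f (x - y) * g y ∂μ
        = ∫⁻ y, (f (x - y) ^ a * g y ^ b) ^ c⁻¹ * (f (x - y) ^ a) ^ (a⁻¹ - c⁻¹)
            * (g y ^ b) ^ (b⁻¹ - c⁻¹) ∂μ := by
          refine lintegral_congr fun y => ?_
          rw [ENNReal.mul_rpow_of_nonneg _ _ (by positivity)]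
          have e1 : f (x - y) = (f (x - y) ^ a) ^ c⁻¹ * (f (x - y) ^ a) ^ (a⁻¹ - c⁻¹) := by
            rw [← ENNReal.rpow_add_of_nonneg _ _ (by positivity) hac, add_sub_cancel,
              ← ENNReal.rpow_mul, mul_inv_cancel₀ ha0.ne', ENNReal.rpow_one]
          have e2 : g y = (g y ^ b) ^ c⁻¹ * (g y ^ b) ^ (b⁻¹ - c⁻¹) := by
            rw [← ENNReal.rpow_add_of_nonneg _ _ (by positivity) hbc, add_sub_cancel,
              ← ENNReal.rpow_mul, mul_inv_cancel₀ hb0.ne', ENNReal.rpow_one]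
          conv_lhs => rw [e1, e2]
          ring
      _ ≤ _ := by rw [← mul_assoc]; exact this
  have hdouble : ∫⁻ x, ∫⁻ y, f (x - y) ^ a * g y ^ b ∂μ ∂μ = A * B := by
    rw [lintegral_lintegral_swap hK.aemeasurable]
    have : ∀ y, ∫⁻ x, f (x - y) ^ a * g y ^ b ∂μ = A * g y ^ b := by
      intro y
      rw [lintegral_mul_const _ (show Measurable fun x => f (x - y) ^ a from
          hfa.comp (measurable_id.sub_const y)),
        lintegral_sub_right_eq_self (fun x => f x ^ a) y]
    simp_rw [this]
    rw [lintegral_const_mul _ hgb]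
  have hI : ∫⁻ x, (∫⁻ y, f (x - y) * g y ∂μ) ^ c ∂μ
      ≤ A * B * (A ^ (a⁻¹ - c⁻¹) * B ^ (b⁻¹ - c⁻¹)) ^ c := by
    rw [← hdouble, ← lintegral_mul_const _ (Measurable.lintegral_prod_right' hK)]
    refine lintegral_mono fun x => ?_
    calc (∫⁻ y, f (x - y) * g y ∂μ) ^ c ≤ _ := ENNReal.rpow_le_rpow (hpt' x) hc0.le
      _ = _ := by
        rw [ENNReal.mul_rpow_of_nonneg _ _ hc0.le, ← ENNReal.rpow_mul, inv_mul_cancel₀ hc0.ne',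
          ENNReal.rpow_one]
  rw [eLpNorm_eq_lintegral_rpow_enorm_toReal hr0 hr, eLpNorm_eq_lintegral_rpow_enorm_toReal hp0 hpt,
    eLpNorm_eq_lintegral_rpow_enorm_toReal hq0 hqt]
  simp only [enorm_eq_self, one_div]
  calc _ ≤ (A * B * (A ^ (a⁻¹ - c⁻¹) * B ^ (b⁻¹ - c⁻¹)) ^ c) ^ c⁻¹ :=
        ENNReal.rpow_le_rpow hI (by positivity)
    _ = (A ^ c⁻¹ * A ^ (a⁻¹ - c⁻¹)) * (B ^ c⁻¹ * B ^ (b⁻¹ - c⁻¹)) := by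
        rw [ENNReal.mul_rpow_of_nonneg _ _ (by positivity), ← ENNReal.rpow_mul,
          mul_inv_cancel₀ hc0.ne', ENNReal.rpow_one, ENNReal.mul_rpow_of_nonneg _ _ (by positivity)]
        ring
    _ = _ := by
        rw [← ENNReal.rpow_add_of_nonneg _ _ (by positivity) hac,
          ← ENNReal.rpow_add_of_nonneg _ _ (by positivity) hbc, add_sub_cancel, add_sub_cancel]

/-- Young's convolution inequality in mixed norm spaces. -/
theorem eLpNorm_eLpNorm_convolution_le {p₁ p₂ p q₁ q₂ q : ℝ≥0∞}
    (hp₁ : 1 ≤ p₁) (hp₂ : 1 ≤ p₂) (hp : 1 ≤ p) (hq₁ : 1 ≤ q₁) (hq₂ : 1 ≤ q₂)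
    (hpp : p₁⁻¹ + p₂⁻¹ = 1 + p⁻¹) (hqq : q₁⁻¹ + q₂⁻¹ = 1 + q⁻¹) {A B : G → H → ℝ≥0∞}
    (hA : Measurable (Function.uncurry A)) (hB : Measurable (Function.uncurry B)) :
    eLpNorm (fun ξ => eLpNorm (fun x => ∫⁻ η, ∫⁻ y, A (x - y) (ξ - η) * B y η ∂μ ∂ν) p μ) q ν
      ≤ eLpNorm (fun ξ => eLpNorm (fun x => A x ξ) p₁ μ) q₁ ν
        * eLpNorm (fun ξ => eLpNorm (fun x => B x ξ) p₂ μ) q₂ ν := by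
  have key : ∀ ξ, eLpNorm (fun x => ∫⁻ η, ∫⁻ y, A (x - y) (ξ - η) * B y η ∂μ ∂ν) p μ
      ≤ ∫⁻ η, eLpNorm (fun x => A x (ξ - η)) p₁ μ * eLpNorm (fun x => B x η) p₂ μ ∂ν := by
    intro ξ
    have hm : Measurable fun z : (G × H) × G => A (z.1.1 - z.2) (ξ - z.1.2) * B z.2 z.1.2 := by
      refine Measurable.mul ?_ ?_
      · exact hA.comp (((measurable_fst.comp measurable_fst).sub measurable_snd).prodMk
          ((measurable_snd.comp measurable_fst).const_sub ξ))
      · exact hB.comp (measurable_snd.prodMk (measurable_snd.comp measurable_fst))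
    have hm' : Measurable (Function.uncurry fun x η => ∫⁻ y, A (x - y) (ξ - η) * B y η ∂μ) :=
      hm.lintegral_prod_right'
    -- Minkowski moves the inner norm under the integral in `η`, so that Young applies in `x` for
    -- each `η`; Young in `ξ` finishes afterwards.
    refine (eLpNorm_lintegral_le hm' hp).trans (lintegral_mono fun η => ?_)
    have hA' : Measurable fun x => A x (ξ - η) := hA.comp measurable_prodMk_right
    have hB' : Measurable fun x => B x η := hB.comp measurable_prodMk_right
    exact eLpNorm_convolution_le (f := fun x => A x (ξ - η)) (g := fun x => B x η)
      hp₁ hp₂ hpp hA' hB'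
  have young := eLpNorm_convolution_le (μ := ν) hq₁ hq₂ hqq
    (measurable_eLpNorm_left (μ := μ) hA p₁) (measurable_eLpNorm_left (μ := μ) hB p₂)
  refine le_trans ?_ young
  exact eLpNorm_mono_enorm fun ξ => by simpa only [enorm_eq_self] using key ξ

end Young

/-! ### Exchanging a tempered distribution with an integral of Schwartz functions. -/

section Fubini

variable {Y V : Type*} [NormedAddCommGroup Y] [NormedSpace ℝ Y]
  [NormedAddCommGroup V] [NormedSpace ℝ V]

theorem tendsto_taylorRem (Φ : 𝓢(V, ℂ)) :
    Filter.Tendsto (taylorRem Φ) (nhds 0) (nhds 0) := by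
  rw [(schwartz_withSeminorms ℂ V ℂ).tendsto_nhds]
  rintro ⟨k, n⟩ ε hε
  obtain ⟨C, hC, h⟩ := taylorRem_seminorm_le Φ k n
  have hlim : Filter.Tendsto (fun m : V => C * ‖m‖ ^ 2) (nhds 0) (nhds 0) := by
    have : Continuous fun m : V => C * ‖m‖ ^ 2 := by fun_prop
    simpa using this.tendsto 0
  filter_upwards [hlim.eventually_lt_const hε, Metric.closedBall_mem_nhds (0 : V) one_pos]
    with m hm hm1
  rw [sub_zero]
  exact (h m (by simpa using hm1)).trans_lt hm

theorem lineDerivOp_sliceCLM (Θ : 𝓢(Y × V, ℂ)) (y : Y) (a : V) :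
    (∂_{a} (sliceCLM y Θ) : 𝓢(V, ℂ)) = sliceCLM y (∂_{((0, a) : Y × V)} Θ : 𝓢(Y × V, ℂ)) := by
  ext t
  rw [sliceCLM_apply, lineDerivOp_apply_eq_fderiv, lineDerivOp_apply_eq_fderiv]
  have h : HasFDerivAt (sliceCLM y Θ) ((fderiv ℝ Θ (y, t)).comp (ContinuousLinearMap.inr ℝ Y V)) t :=
    (Θ.hasFDerivAt (y, t)).comp t (hasFDerivAt_prodMk_right y t)
  rw [h.fderiv]
  simp

variable (V) in
/-- Bounded continuous functions with values in the `n`-linear maps on `V`. -/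
def JetSpace (n : ℕ) : Type _ := BoundedContinuousFunction V (V [×n]→L[ℝ] ℂ)

instance (n : ℕ) : NormedAddCommGroup (JetSpace V n) :=
  inferInstanceAs (NormedAddCommGroup (BoundedContinuousFunction V (V [×n]→L[ℝ] ℂ)))

instance (n : ℕ) : NormedSpace ℂ (JetSpace V n) :=
  inferInstanceAs (NormedSpace ℂ (BoundedContinuousFunction V (V [×n]→L[ℝ] ℂ)))

instance (n : ℕ) : CompleteSpace (JetSpace V n) :=
  inferInstanceAs (CompleteSpace (BoundedContinuousFunction V (V [×n]→L[ℝ] ℂ)))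

/-- The value of an element of `JetSpace V n`. -/
def JetSpace.val {n : ℕ} (f : JetSpace V n) (t : V) : V [×n]→L[ℝ] ℂ :=
  (show BoundedContinuousFunction V (V [×n]→L[ℝ] ℂ) from f) t

theorem JetSpace.ext {n : ℕ} {f f' : JetSpace V n} (h : ∀ t w, f.val t w = f'.val t w) :
    f = f' :=
  BoundedContinuousFunction.ext fun t => ContinuousMultilinearMap.ext (h t)

theorem JetSpace.norm_val_le {n : ℕ} (f : JetSpace V n) (t : V) : ‖f.val t‖ ≤ ‖f‖ :=
  BoundedContinuousFunction.norm_coe_le_norm (f : BoundedContinuousFunction V (V [×n]→L[ℝ] ℂ)) t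

theorem JetSpace.norm_le {n : ℕ} {f : JetSpace V n} {C : ℝ} (hC : 0 ≤ C)
    (h : ∀ t, ‖f.val t‖ ≤ C) : ‖f‖ ≤ C :=
  (BoundedContinuousFunction.norm_le
    (f := (f : BoundedContinuousFunction V (V [×n]→L[ℝ] ℂ))) hC).2 h

/-- Evaluation of an element of `JetSpace V n` at a point and a tuple of vectors. -/
def jetEval {n : ℕ} (t : V) (w : Fin n → V) : JetSpace V n →L[ℂ] ℂ :=
  LinearMap.mkContinuous
    { toFun := fun f => f.val t w
      map_add' := fun _ _ => rfl
      map_smul' := fun _ _ => rfl } (∏ i, ‖w i‖) fun f => by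
    rw [mul_comm]
    refine ((f.val t).le_opNorm w).trans ?_
    gcongr
    exact f.norm_val_le t

/-- The function `t ↦ |t|^k D^n φ(t)`, as an element of `JetSpace V n`. -/
def jetFun (k n : ℕ) (φ : 𝓢(V, ℂ)) : JetSpace V n :=
  BoundedContinuousFunction.ofNormedAddCommGroup
    (fun t => ‖t‖ ^ k • iteratedFDeriv ℝ n φ t)
    (by
      have : Continuous (iteratedFDeriv ℝ n φ) :=
        (φ.smooth n).continuous_iteratedFDeriv le_rfl
      fun_prop)
    (SchwartzMap.seminorm ℂ k n φ)
    (fun t => by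
      have := SchwartzMap.le_seminorm ℂ k n φ t
      rwa [norm_smul, norm_pow, norm_norm])

theorem jetFun_val (k n : ℕ) (φ : 𝓢(V, ℂ)) (t : V) :
    (jetFun k n φ).val t = ‖t‖ ^ k • iteratedFDeriv ℝ n φ t := rfl

theorem jetFun_val_apply (k n : ℕ) (φ : 𝓢(V, ℂ)) (t : V) (w : Fin n → V) :
    (jetFun k n φ).val t w = (‖t‖ ^ k : ℝ) * (∂^{w} φ : 𝓢(V, ℂ)) t := by
  rw [jetFun_val, iteratedLineDerivOp_eq_iteratedFDeriv, _root_.smul_apply,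
    Complex.real_smul]

theorem norm_jetFun (k n : ℕ) (φ : 𝓢(V, ℂ)) :
    ‖jetFun k n φ‖ = SchwartzMap.seminorm ℂ k n φ := by
  refine le_antisymm (JetSpace.norm_le (apply_nonneg _ _) fun t => ?_)
    (SchwartzMap.seminorm_le_bound ℂ k n φ (norm_nonneg (jetFun k n φ)) fun t => ?_)
  · rw [jetFun_val, norm_smul, norm_pow, norm_norm]
    exact SchwartzMap.le_seminorm ℂ k n φ t
  · have := (jetFun k n φ).norm_val_le t
    rwa [jetFun_val, norm_smul, norm_pow, norm_norm] at this

/-- The weighted `n`-jet `φ ↦ |·|^k D^n φ` as a continuous linear map. -/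
def weightedJet (k n : ℕ) : 𝓢(V, ℂ) →L[ℂ] JetSpace V n :=
  mkCLMtoNormedSpace (𝕜 := ℂ) (σ := RingHom.id ℂ) (jetFun k n)
    (fun φ ψ => JetSpace.ext fun t w => by
      change (jetFun k n (φ + ψ)).val t w = (jetFun k n φ).val t w + (jetFun k n ψ).val t w
      simp only [jetFun_val_apply, iteratedLineDerivOp_add, _root_.add_apply, mul_add])
    (fun c φ => JetSpace.ext fun t w => by
      change (jetFun k n (c • φ)).val t w = c * (jetFun k n φ).val t w
      simp only [jetFun_val_apply, iteratedLineDerivOp_smul, _root_.smul_apply, smul_eq_mul]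
      ring)
    ⟨{(k, n)}, 1, zero_le_one, fun φ => by
      rw [one_mul, Finset.sup_singleton, norm_jetFun]
      rfl⟩

theorem norm_weightedJet (k n : ℕ) (φ : 𝓢(V, ℂ)) :
    ‖weightedJet k n φ‖ = SchwartzMap.seminorm ℂ k n φ := norm_jetFun k n φ

/-- The embedding of the Schwartz space by finitely many weighted jets. -/
def jetEmbedding (s : Finset (ℕ × ℕ)) : 𝓢(V, ℂ) →L[ℂ] ((i : s) → JetSpace V i.1.2) :=
  ContinuousLinearMap.pi fun i => weightedJet i.1.1 i.1.2

theorem sup_seminorm_le_norm_jetEmbedding (s : Finset (ℕ × ℕ)) (φ : 𝓢(V, ℂ)) :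
    s.sup (schwartzSeminormFamily ℂ V ℂ) φ ≤ ‖jetEmbedding s φ‖ := by
  refine Seminorm.finset_sup_apply_le (norm_nonneg _) fun i hi => ?_
  have := norm_le_pi_norm (jetEmbedding s φ) ⟨i, hi⟩
  exact (norm_weightedJet i.1 i.2 φ).symm.le.trans this

/-- Continuity bounds `F` by finitely many Schwartz seminorms, and these are norms of weighted jets.
So `F` is bounded on the image of the embedding, and Hahn–Banach extends it to the whole Banach
space of jets. -/
theorem exists_jetEmbedding_extension (F : 𝓢'(V, ℂ)) : ∃ (s : Finset (ℕ × ℕ))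
    (F' : ((i : s) → JetSpace V i.1.2) →L[ℂ] ℂ),
    ∀ φ, F' (jetEmbedding s φ) = F φ := by
  obtain ⟨s₀, C, -, h⟩ := Seminorm.bound_of_continuous (schwartz_withSeminorms ℂ V ℂ)
    ((normSeminorm ℂ ℂ).comp F.toLinearMap) (continuous_norm.comp F.continuous)
  -- The pair `(0, 0)` adds the sup norm, which makes the embedding injective, so that `F` is well
  -- defined on its range.
  set s := insert (0, 0) s₀ with hs
  have hb : ∀ φ, ‖F φ‖ ≤ C * ‖jetEmbedding s φ‖ := fun φ => by
    refine (h φ).trans ?_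
    change (C : ℝ) * _ ≤ _
    gcongr
    refine le_trans ?_ (sup_seminorm_le_norm_jetEmbedding s φ)
    exact Finset.sup_mono (f := schwartzSeminormFamily ℂ V ℂ) (Finset.subset_insert _ _) φ
  have hinj : Function.Injective (jetEmbedding (V := V) s).toLinearMap := by
    refine (injective_iff_map_eq_zero _).2 fun φ hφ => ?_
    have h0 : jetEmbedding s φ = 0 := hφ
    ext t
    have h1 := SchwartzMap.norm_le_seminorm ℂ φ t
    have h2 : SchwartzMap.seminorm ℂ 0 0 φ ≤ 0 := by
      have := norm_le_pi_norm (jetEmbedding s φ) ⟨(0, 0), Finset.mem_insert_self _ _⟩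
      rw [h0, norm_zero, ← h0] at this
      exact (norm_weightedJet 0 0 φ).symm.le.trans this
    simpa using h1.trans h2
  let e := LinearEquiv.ofInjective (jetEmbedding (V := V) s).toLinearMap hinj
  let f : StrongDual ℂ (LinearMap.range (jetEmbedding (V := V) s).toLinearMap) :=
    LinearMap.mkContinuous (F.toLinearMap ∘ₗ e.symm.toLinearMap) C fun x => by
      obtain ⟨φ, rfl⟩ := e.surjective x
      change ‖F (e.symm (e φ))‖ ≤ _
      rw [LinearEquiv.symm_apply_apply]
      exact hb φ
  obtain ⟨F', hF', -⟩ := exists_extension_norm_eq _ f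
  refine ⟨s, F', fun φ => ?_⟩
  refine (hF' (e φ)).trans ?_
  change F (e.symm (e φ)) = _
  rw [LinearEquiv.symm_apply_apply]

variable [FiniteDimensional ℝ Y]

theorem sliceCLM_eq_taylor (Θ : 𝓢(Y × V, ℂ)) (x w : Y) :
    sliceCLM w Θ = sliceCLM x (taylorRem Θ (w - x, 0)) + sliceCLM x Θ
      + ∑ i, ((Module.finBasis ℝ Y).repr (w - x) i : ℂ) •
        sliceCLM x (∂_{((Module.finBasis ℝ Y i, 0) : Y × V)} Θ : 𝓢(Y × V, ℂ)) := by
  have h2 := lineDerivOp_inl_eq_sum Θ (w - x)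
  have h3 : sliceCLM w Θ = sliceCLM x (compSubConstCLM ℂ (-((w - x, 0) : Y × V)) Θ) := by
    ext t; simp
  rw [h3]
  simp only [taylorRem, map_sub, h2, map_sum, map_smul]
  abel

/-- In the first-order Taylor expansion of `Θ` in its first variable, the remainder tends to zero in
the Schwartz topology and the linear terms have coefficients tending to zero. -/
theorem continuous_sliceCLM (Θ : 𝓢(Y × V, ℂ)) : Continuous fun y => sliceCLM y Θ := by
  rw [continuous_iff_continuousAt]
  intro x
  have h1 : Filter.Tendsto (fun w : Y => sliceCLM x (taylorRem Θ (w - x, 0))) (nhds x) (nhds 0) := by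
    have a : Filter.Tendsto (fun w : Y => ((w - x, 0) : Y × V)) (nhds x) (nhds 0) := by
      have : Continuous fun w : Y => ((w - x, 0) : Y × V) := by fun_prop
      simpa [Prod.zero_eq_mk] using this.tendsto x
    simpa [Function.comp_def] using ((sliceCLM x).continuous.tendsto 0).comp ((tendsto_taylorRem Θ).comp a)
  have h2 : ∀ i, Filter.Tendsto (fun w : Y => ((Module.finBasis ℝ Y).repr (w - x) i : ℂ) •
      sliceCLM x (∂_{((Module.finBasis ℝ Y i, 0) : Y × V)} Θ : 𝓢(Y × V, ℂ))) (nhds x) (nhds 0) := by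
    intro i
    have a : Continuous fun w : Y => ((Module.finBasis ℝ Y).repr (w - x) i : ℂ) := by
      have : Continuous fun w : Y => (Module.finBasis ℝ Y).coord i w :=
        LinearMap.continuous_of_finiteDimensional _
      exact Complex.continuous_ofReal.comp (this.comp (continuous_id.sub continuous_const))
    simpa using (a.tendsto x).smul_const
      (sliceCLM x (∂_{((Module.finBasis ℝ Y i, 0) : Y × V)} Θ : 𝓢(Y × V, ℂ)))
  have h3 := (h1.add_const (sliceCLM x Θ)).add (tendsto_finsetSum Finset.univ fun i _ => h2 i)
  simp only [← sliceCLM_eq_taylor, zero_add, Finset.sum_const_zero, add_zero] at h3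
  exact h3

/-- A contraction is the case of `idTensorFun` whose target is functions on a point, so
`hasFDerivAt_idTensorFun` applies; the derivatives along the point vanish. -/
theorem lineDerivOp_contractSnd (h : 𝓢'(V, ℂ)) (Ψ : 𝓢(Y × V, ℂ)) (a : Y) :
    (∂_{a} (contractSnd h Ψ) : 𝓢(Y, ℂ))
      = contractSnd h (∂_{((a, 0) : Y × V)} Ψ : 𝓢(Y × V, ℂ)) := by
  ext x
  rw [lineDerivOp_apply_eq_fderiv]
  have e : ∀ Ψ' : 𝓢(Y × V, ℂ), (contractSnd h Ψ' : Y → ℂ) = fun x =>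
      idTensorFun (constPoint.comp (⟨h.toLinearMap, h.continuous⟩ : 𝓢(V, ℂ) →L[ℂ] ℂ)) Ψ'
        (x, PUnit.unit) := fun _ => rfl
  have h1 := (hasFDerivAt_idTensorFun
    (constPoint.comp (⟨h.toLinearMap, h.continuous⟩ : 𝓢(V, ℂ) →L[ℂ] ℂ)) Ψ (x, PUnit.unit)).comp x
      (hasFDerivAt_prodMk_left (𝕜 := ℝ) x (PUnit.unit : PUnit.{1}))
  rw [e Ψ]
  erw [h1.fderiv]
  rw [lineDerivOp_inl_eq_sum, map_sum]
  simp only [map_smul, _root_.sum_apply, _root_.smul_apply]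
  have z : ∀ i, (Module.finBasis ℝ PUnit.{1}).repr PUnit.unit i = 0 := fun i => by
    rw [show (PUnit.unit : PUnit.{1}) = 0 from rfl, map_zero]; rfl
  simp [coordFst, coordSnd, z]
  rfl

variable [MeasurableSpace Y] [BorelSpace Y] {μ : Measure Y} [μ.HasTemperateGrowth]

/-- Powers of `‖y‖` are absorbed by the seminorms of `Θ` (`sliceCLM_seminorm_le`), so the jets of
the slices decay faster than any power, and `μ` has temperate growth. -/
theorem integrable_jetEmbedding (s : Finset (ℕ × ℕ)) (Θ : 𝓢(Y × V, ℂ)) :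
    Integrable (fun y => jetEmbedding s (sliceCLM y Θ)) μ := by
  have hc : Continuous fun y => jetEmbedding s (sliceCLM y Θ) :=
    (jetEmbedding s).continuous.comp (continuous_sliceCLM Θ)
  have hb : ∀ j : ℕ, ∃ C : ℝ, ∀ y, ‖y‖ ^ j * ‖jetEmbedding s (sliceCLM y Θ)‖ ≤ C := by
    intro j
    refine ⟨∑ i ∈ s, SchwartzMap.seminorm ℂ (j + i.1) i.2 Θ, fun y => ?_⟩
    rw [show ‖y‖ ^ j = ‖((‖y‖ ^ j : ℝ) : ℂ)‖ by simp, ← norm_smul]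
    refine (pi_norm_le_iff_of_nonneg (Finset.sum_nonneg fun _ _ => apply_nonneg _ _)).2 fun i => ?_
    change ‖((‖y‖ ^ j : ℝ) : ℂ) • weightedJet i.1.1 i.1.2 (sliceCLM y Θ)‖ ≤ _
    rw [norm_smul, norm_weightedJet, Complex.norm_real, norm_pow, norm_norm]
    refine (sliceCLM_seminorm_le y Θ j i.1.1 i.1.2).trans ?_
    exact Finset.single_le_sum (f := fun i : ℕ × ℕ => SchwartzMap.seminorm ℂ (j + i.1) i.2 Θ)
      (fun _ _ => apply_nonneg _ _) i.2
  obtain ⟨C₁, h₁⟩ := hb 0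
  obtain ⟨C₂, h₂⟩ := hb (0 + μ.integrablePower)
  have := integrable_of_le_of_pow_mul_le (μ := μ) (k := 0) (fun y => by simpa using h₁ y) h₂
    hc.aestronglyMeasurable
  rw [← integrable_norm_iff hc.aestronglyMeasurable]
  simpa using this

variable [FiniteDimensional ℝ V]

/-- Integration against `μ` is itself a tempered distribution, so differentiating under the integral
sign is `lineDerivOp_contractSnd` after exchanging the two variables. -/
theorem lineDerivOp_eq_integral {Θ : 𝓢(Y × V, ℂ)} {φ : 𝓢(V, ℂ)}
    (h : ∀ t, φ t = ∫ y, Θ (y, t) ∂μ) (a t : V) :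
    (∂_{a} φ : 𝓢(V, ℂ)) t = ∫ y, (∂_{((0, a) : Y × V)} Θ : 𝓢(Y × V, ℂ)) (y, t) ∂μ := by
  let e := ContinuousLinearEquiv.prodComm ℝ V Y
  have h1 : φ = contractSnd μ.toTemperedDistribution (compCLMOfContinuousLinearEquiv ℂ e Θ) := by
    ext t
    simp [h, e]
  rw [h1, lineDerivOp_contractSnd, contractSnd_apply]
  refine (Measure.toTemperedDistribution_apply μ _).trans ?_
  refine integral_congr_ae (Filter.Eventually.of_forall fun y => ?_)
  simp only [sliceCLM_apply]
  rw [lineDerivOp_compCLMOfContinuousLinearEquiv]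
  rfl

theorem iteratedLineDerivOp_eq_integral {n : ℕ} : ∀ {Θ : 𝓢(Y × V, ℂ)} {φ : 𝓢(V, ℂ)},
    (∀ t, φ t = ∫ y, Θ (y, t) ∂μ) → ∀ (w : Fin n → V) (t : V),
    (∂^{w} φ : 𝓢(V, ℂ)) t = ∫ y, (∂^{w} (sliceCLM y Θ) : 𝓢(V, ℂ)) t ∂μ := by
  induction n with
  | zero => intro Θ φ h w t; simpa using h t
  | succ n ih =>
    intro Θ φ h w t
    rw [iteratedLineDerivOp_succ_right, ih (lineDerivOp_eq_integral h _)]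
    simp only [iteratedLineDerivOp_succ_right w, lineDerivOp_sliceCLM]

/-- Fubini's theorem for a tempered distribution and an integral of Schwartz functions. -/
theorem distrib_integral_eq (F : 𝓢'(V, ℂ)) {Θ : 𝓢(Y × V, ℂ)} {φ : 𝓢(V, ℂ)}
    (h : ∀ t, φ t = ∫ y, Θ (y, t) ∂μ) : F φ = ∫ y, F (sliceCLM y Θ) ∂μ := by
  obtain ⟨s, F', hF'⟩ := exists_jetEmbedding_extension F
  have hi := integrable_jetEmbedding (μ := μ) s Θ
  simp_rw [← hF']
  rw [ContinuousLinearMap.integral_comp_comm F' hi]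
  congr 1
  -- Two jets agree if all their evaluations do. Evaluations commute with the Bochner integral,
  -- which reduces the identity to differentiation under the integral sign.
  refine funext fun i => JetSpace.ext fun t w => ?_
  let ev := (jetEval t w).comp (ContinuousLinearMap.proj (R := ℂ)
    (φ := fun i : s => JetSpace V i.1.2) i)
  have h1 := ev.integral_comp_comm hi
  have h2 : ∀ ψ : 𝓢(V, ℂ),
      ev (jetEmbedding s ψ) = (‖t‖ ^ i.1.1 : ℝ) * (∂^{w} ψ : 𝓢(V, ℂ)) t :=
    fun ψ => jetFun_val_apply _ _ ψ t w
  change ev (jetEmbedding s φ) = ev _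
  rw [← h1, h2]
  simp_rw [h2]
  rw [integral_const_mul, iteratedLineDerivOp_eq_integral h]

end Fubini

/-! ### Tensor products of Schwartz functions. -/

section TensorSchwartz

variable {E F : Type*} [NormedAddCommGroup E] [NormedSpace ℝ E] [FiniteDimensional ℝ E]
  [NormedAddCommGroup F] [NormedSpace ℝ F] [FiniteDimensional ℝ F]

/-- The tensor product `(x, y) ↦ A(x) B(y)` of two Schwartz functions. -/
def tensorSchwartz (A : 𝓢(E, ℂ)) (B : 𝓢(F, ℂ)) : 𝓢(E × F, ℂ) :=
  -- `A` is viewed on `E × PUnit`; the operator sends a function on the point with value `c` to `c •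
  -- B`.
  idTensorCLM (((BoundedContinuousFunction.evalCLM ℂ PUnit.unit).comp
      (toBoundedContinuousFunctionCLM ℂ PUnit.{1} ℂ)).smulRight B)
    (compCLMOfContinuousLinearEquiv ℂ (ContinuousLinearEquiv.prodUnique ℝ E PUnit.{1}) A)

end TensorSchwartz

/-! ### Characters and partial Fourier inversion. -/

section Character

variable {V : Type*} [NormedAddCommGroup V] [InnerProductSpace ℝ V]

theorem character_add_left (ξ η t : V) : character (ξ + η) t = character ξ t * character η t := by
  rw [character, character, character, ← Complex.exp_add, inner_add_left]
  push_cast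
  ring_nf

theorem character_add_right (ξ t u : V) : character ξ (t + u) = character ξ t * character ξ u := by
  rw [character, character, character, ← Complex.exp_add, inner_add_right]
  push_cast
  ring_nf

theorem character_comm (ξ t : V) : character ξ t = character t ξ := by
  rw [character, character, real_inner_comm]

@[simp]
theorem norm_character (ξ t : V) : ‖character ξ t‖ = 1 := by
  rw [character, show (2 * Real.pi * Complex.I * (inner ℝ ξ t : ℝ) : ℂ)
    = ((2 * Real.pi * inner ℝ ξ t : ℝ) : ℂ) * Complex.I by push_cast; ring,
    Complex.norm_exp_ofReal_mul_I]

@[simp]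
theorem conj_character (ξ t : V) : starRingEnd ℂ (character ξ t) = character (-ξ) t := by
  rw [character, character, ← Complex.exp_conj]
  simp [inner_neg_left, Complex.conj_ofReal, map_ofNat]

theorem character_neg_right (ξ t : V) : character ξ (-t) = character (-ξ) t := by
  simp [character]

theorem hasTemperateGrowth_character_comp {D : Type*} [NormedAddCommGroup D] [NormedSpace ℝ D]
    {a b : D → V} (ha : a.HasTemperateGrowth) (hb : b.HasTemperateGrowth) :
    (fun z => character (a z) (b z)).HasTemperateGrowth := by
  have h1 := (hasTemperateGrowth_character (1 : ℝ)).comp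
    ((innerSL ℝ (E := V)).bilinear_hasTemperateGrowth ha hb)
  convert h1 using 2 with z
  simp [character]
  rfl

variable [FiniteDimensional ℝ V] [MeasurableSpace V] [BorelSpace V]

theorem partialFourier_eq_integral_character (Ψ : 𝓢(V × V, ℂ)) (x t : V) :
    partialFourier Ψ (x, t) = ∫ ξ, character (-ξ) t * Ψ (x, ξ) := by
  rw [partialFourier_apply]
  refine integral_congr_ae (Filter.Eventually.of_forall fun ξ => ?_)
  simp only [character, inner_neg_left]
  congr 2
  push_cast
  ring

theorem integral_character_mul_partialFourier (Ψ : 𝓢(V × V, ℂ)) (x t : V) :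
    ∫ ξ, character ξ t * partialFourier Ψ (x, ξ) = Ψ (x, t) := by
  have h1 : 𝓕⁻ (𝓕 (sliceCLM x Ψ)) = sliceCLM x Ψ := FourierTransform.fourierInv_fourier_eq _
  have h2 := congrArg (fun f : 𝓢(V, ℂ) => f t) h1
  simp only [sliceCLM_apply] at h2
  rw [← h2, fourierInv_coe, Real.fourierInv_eq']
  refine integral_congr_ae (Filter.Eventually.of_forall fun ξ => ?_)
  change _ * _ = _ * _
  congr 1
  rw [character]
  congr 1
  push_cast
  ring

end Character

/-! ### Inversion formula for the short-time Fourier transform. -/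

section ChangeOfWindow

variable {V : Type*} [NormedAddCommGroup V] [InnerProductSpace ℝ V]

/-- The linear involution `(y, t) ↦ (t - y, t)`. -/
def reflectShear : (V × V) ≃L[ℝ] (V × V) :=
  ContinuousLinearEquiv.equivOfInverse
    ((ContinuousLinearMap.snd ℝ V V - ContinuousLinearMap.fst ℝ V V).prod
      (ContinuousLinearMap.snd ℝ V V))
    ((ContinuousLinearMap.snd ℝ V V - ContinuousLinearMap.fst ℝ V V).prod
      (ContinuousLinearMap.snd ℝ V V))
    (fun z => by ext <;> simp) (fun z => by ext <;> simp)

/-- The linear map `((y, η), t) ↦ ((y, η), t - y)`. -/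
def shiftShear : ((V × V) × V) ≃L[ℝ] ((V × V) × V) :=
  ContinuousLinearEquiv.equivOfInverse
    ((ContinuousLinearMap.fst ℝ (V × V) V).prod (ContinuousLinearMap.snd ℝ (V × V) V
      - (ContinuousLinearMap.fst ℝ V V).comp (ContinuousLinearMap.fst ℝ (V × V) V)))
    ((ContinuousLinearMap.fst ℝ (V × V) V).prod (ContinuousLinearMap.snd ℝ (V × V) V
      + (ContinuousLinearMap.fst ℝ V V).comp (ContinuousLinearMap.fst ℝ (V × V) V)))
    (fun z => by ext <;> simp) (fun z => by ext <;> simp)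

variable [FiniteDimensional ℝ V]

/-- The Schwartz function `((y, η), t) ↦ S(y, η) (M_η T_y g)(t)`. -/
def shiftSchwartz (S : 𝓢(V × V, ℂ)) (g : 𝓢(V, ℂ)) : 𝓢((V × V) × V, ℂ) :=
  smulLeftCLM ℂ (fun z : (V × V) × V => character z.1.2 z.2)
    (compCLMOfContinuousLinearEquiv ℂ shiftShear (tensorSchwartz S g))

theorem shiftSchwartz_apply (S : 𝓢(V × V, ℂ)) (g : 𝓢(V, ℂ)) (z : V × V) (t : V) :
    shiftSchwartz S g (z, t) = S z * timeFreqShift z.1 z.2 g t := by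
  have h : (fun z : (V × V) × V => character z.1.2 z.2).HasTemperateGrowth :=
    hasTemperateGrowth_character_comp
      ((ContinuousLinearMap.snd ℝ V V).comp
        (ContinuousLinearMap.fst ℝ (V × V) V)).hasTemperateGrowth
      (ContinuousLinearMap.snd ℝ (V × V) V).hasTemperateGrowth
  rw [shiftSchwartz, smulLeftCLM_apply_apply h, timeFreqShift_apply]
  change _ * (S z * g (t - z.1)) = _
  ring

theorem sliceCLM_conj_shiftSchwartz (S : 𝓢(V × V, ℂ)) (g : 𝓢(V, ℂ)) (z : V × V) :
    sliceCLM z (conjSchwartz (shiftSchwartz S g))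
      = starRingEnd ℂ (S z) • conjSchwartz (timeFreqShift z.1 z.2 g) := by
  ext t
  simp [shiftSchwartz_apply]

theorem distrib_slice_conj_shiftSchwartz (F : 𝓢'(V, ℂ)) (S : 𝓢(V × V, ℂ)) (g : 𝓢(V, ℂ))
    (z : V × V) : F (sliceCLM z (conjSchwartz (shiftSchwartz S g)))
      = starRingEnd ℂ (S z) * stft g F z.1 z.2 := by
  rw [sliceCLM_conj_shiftSchwartz, map_smul, smul_eq_mul, stft]

/-- A smooth cutoff times the transform is a contraction of a Schwartz function by `F`, hence a
Schwartz function. Near a point where the cutoff does not vanish, divide by it. -/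
theorem continuous_stft (g : 𝓢(V, ℂ)) (F : 𝓢'(V, ℂ)) :
    Continuous fun z : V × V => stft g F z.1 z.2 := by
  rw [continuous_iff_continuousAt]
  intro z₀
  obtain ⟨χ, -, hc, hs, -, h1⟩ := exists_contDiff_tsupport_subset (n := ⊤)
    (Filter.univ_mem (f := nhds z₀))
  have hc' : HasCompactSupport fun z => (χ z : ℂ) := hc.comp_left (g := Complex.ofReal) (by simp)
  let S : 𝓢(V × V, ℂ) := hc'.toSchwartzMap (Complex.ofRealCLM.contDiff.comp hs)
  have hS : ∀ z, S z = χ z := fun z => rfl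
  have e : ∀ z, contractSnd F (conjSchwartz (shiftSchwartz S g)) z
      = χ z * stft g F z.1 z.2 := fun z => by
    rw [contractSnd_apply, distrib_slice_conj_shiftSchwartz, hS, Complex.conj_ofReal]
  have hχ : ContinuousAt (fun z => (χ z : ℂ)) z₀ :=
    (Complex.continuous_ofReal.comp hs.continuous).continuousAt
  have hne : (χ z₀ : ℂ) ≠ 0 := by simp [h1]
  have hq : ContinuousAt (fun z => contractSnd F (conjSchwartz (shiftSchwartz S g)) z / (χ z : ℂ))
      z₀ := (SchwartzMap.continuous _).continuousAt.div hχ hne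
  refine hq.congr ?_
  filter_upwards [hχ.eventually_ne hne] with z hz
  rw [e, mul_div_cancel_left₀ _ hz]

variable [MeasurableSpace V] [BorelSpace V]

instance : (volume : Measure (V × V)).HasTemperateGrowth := by
  rw [Measure.volume_eq_prod]
  infer_instance

/-- The short-time Fourier transform of a Schwartz function, as a Schwartz function. -/
def stftSchwartz (g φ : 𝓢(V, ℂ)) : 𝓢(V × V, ℂ) :=
  partialFourier (compCLMOfContinuousLinearEquiv ℂ reflectShear (tensorSchwartz (conjSchwartz g) φ))

theorem stftSchwartz_apply (g φ : 𝓢(V, ℂ)) (y η : V) :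
    stftSchwartz g φ (y, η)
      = ∫ t, character (-t) η * (starRingEnd ℂ (g (t - y)) * φ t) :=
  partialFourier_eq_integral_character _ _ _

theorem integral_character_mul_stftSchwartz (g φ : 𝓢(V, ℂ)) (y t : V) :
    ∫ η, character η t * stftSchwartz g φ (y, η) = starRingEnd ℂ (g (t - y)) * φ t :=
  integral_character_mul_partialFourier _ _ _

/-- Covariance: the substitution `t ↦ t + x` leaves only factors of modulus one outside the
integral. -/
theorem norm_stftSchwartz_timeFreqShift (g γ : 𝓢(V, ℂ)) (x ξ y η : V) :
    ‖stftSchwartz g (timeFreqShift x ξ γ) (y, η)‖ = ‖stftSchwartz g γ (y - x, η - ξ)‖ := by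
  rw [stftSchwartz_apply, stftSchwartz_apply, ← integral_add_right_eq_self _ x]
  have : ∀ t, character (-(t + x)) η * (starRingEnd ℂ (g (t + x - y)) *
        timeFreqShift x ξ γ (t + x))
      = character (-x) η * character ξ x * (character (-t) (η - ξ) *
        (starRingEnd ℂ (g (t - (y - x))) * γ t)) := by
    intro t
    rw [timeFreqShift_apply, neg_add, character_add_left, character_add_right, sub_eq_add_neg η,
      character_add_right (-t), show t - (y - x) = t + x - y by abel, add_sub_cancel_right,
      character_neg_right (-t), neg_neg, character_comm t ξ]
    ring
  simp_rw [this]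
  rw [integral_const_mul, norm_mul, norm_mul, norm_character, norm_character, one_mul, one_mul]

/-- Integrating in `η` first, Fourier inversion turns the integrand into `|g(t - y)|² φ(t)`; the
integral in `y` then gives the squared norm of `g`. -/
theorem integral_shiftSchwartz (g φ : 𝓢(V, ℂ)) (t : V) :
    ∫ z : V × V, shiftSchwartz (stftSchwartz g φ) g (z, t) = (∫ u, ‖g u‖ ^ 2 : ℝ) * φ t := by
  have hi : Integrable fun z : V × V => shiftSchwartz (stftSchwartz g φ) g (z, t) :=
    (sliceCLM t (compCLMOfContinuousLinearEquiv ℂ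
      (ContinuousLinearEquiv.prodComm ℝ V (V × V))
        (shiftSchwartz (stftSchwartz g φ) g))).integrable
  rw [Measure.volume_eq_prod, integral_prod _ hi]
  have : ∀ y, ∫ η, shiftSchwartz (stftSchwartz g φ) g ((y, η), t)
      = ((‖g (t - y)‖ ^ 2 : ℝ) : ℂ) * φ t := by
    intro y
    simp only [shiftSchwartz_apply, timeFreqShift_apply]
    have e : ∀ η, stftSchwartz g φ (y, η) * (character η t * g (t - y))
        = (character η t * stftSchwartz g φ (y, η)) * g (t - y) := fun η => by ring
    simp_rw [e]
    rw [integral_mul_const, integral_character_mul_stftSchwartz, ← Complex.normSq_eq_norm_sq,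
      Complex.normSq_eq_conj_mul_self]
    ring
  simp_rw [this]
  rw [integral_mul_const, integral_complex_ofReal,
    integral_sub_left_eq_self (fun u => ‖g u‖ ^ 2) volume t]

/-- The action of a tempered distribution in terms of its short-time Fourier transform. -/
theorem integral_stftSchwartz_mul_stft (g φ : 𝓢(V, ℂ)) (F : 𝓢'(V, ℂ)) :
    ((∫ u, ‖g u‖ ^ 2 : ℝ) : ℂ) * F (conjSchwartz φ)
      = ∫ z : V × V, starRingEnd ℂ (stftSchwartz g φ z) * stft g F z.1 z.2 := by
  rw [← smul_eq_mul, ← map_smul, distrib_integral_eq (μ := (volume : Measure (V × V))) F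
    (Θ := conjSchwartz (shiftSchwartz (stftSchwartz g φ) g))]
  · simp_rw [distrib_slice_conj_shiftSchwartz]
  · intro t
    simp only [conjSchwartz_apply]
    rw [integral_conj, integral_shiftSchwartz]
    simp

theorem integral_norm_sq_pos {g : 𝓢(V, ℂ)} (hg : g ≠ 0) : 0 < ∫ u, ‖g u‖ ^ 2 := by
  have hi : Integrable fun u => ‖g u‖ ^ 2 := by
    have := (g.memLp 2).integrable_norm_pow (by norm_num)
    simpa using this
  obtain ⟨u, hu⟩ : ∃ u, g u ≠ 0 := by
    by_contra! h
    exact hg (SchwartzMap.ext h)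
  refine (integral_pos_iff_support_of_nonneg (fun _ => by positivity) hi).2 ?_
  refine IsOpen.measure_pos _ ?_ ⟨u, by simpa using hu⟩
  exact (g.continuous.norm.pow 2).isOpen_support

/-- The inversion formula is applied to the shifted window `M_ξ T_x γ`. Covariance turns the kernel
into `V_g γ` at `(· - x, · - ξ)`, and the substitution `(x - y, ξ - η)` exhibits a convolution,
whence the reflected arguments. -/
theorem enorm_stft_le (g γ : 𝓢(V, ℂ)) (F : 𝓢'(V, ℂ)) (x ξ : V) :
    ENNReal.ofReal (∫ u, ‖g u‖ ^ 2) * ‖stft γ F x ξ‖ₑ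
      ≤ ∫⁻ η, ∫⁻ y, ‖stft g F (x - y) (ξ - η)‖ₑ * ‖stftSchwartz g γ (-y, -η)‖ₑ := by
  have h := integral_stftSchwartz_mul_stft g (timeFreqShift x ξ γ) F
  have h0 : 0 ≤ ∫ u, ‖g u‖ ^ 2 := integral_nonneg fun _ => by positivity
  have hm : Measurable fun z : V × V => ‖stft g F z.1 z.2‖ₑ * ‖stftSchwartz g γ (z.1 - x, z.2 - ξ)‖ₑ := by
    refine (continuous_stft g F).measurable.enorm.mul ?_
    exact ((stftSchwartz g γ).continuous.comp (by fun_prop)).measurable.enorm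
  calc ENNReal.ofReal (∫ u, ‖g u‖ ^ 2) * ‖stft γ F x ξ‖ₑ
      = ‖((∫ u, ‖g u‖ ^ 2 : ℝ) : ℂ) * F (conjSchwartz (timeFreqShift x ξ γ))‖ₑ := by
        rw [enorm_mul, stft]
        congr 1
        rw [← ofReal_norm, Complex.norm_real, Real.norm_of_nonneg h0]
    _ ≤ ∫⁻ z : V × V, ‖stft g F z.1 z.2‖ₑ * ‖stftSchwartz g γ (z.1 - x, z.2 - ξ)‖ₑ := by
        rw [h]
        refine (enorm_integral_le_lintegral_enorm _).trans_eq (lintegral_congr fun z => ?_)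
        rw [enorm_mul, mul_comm]
        congr 1
        rw [← ofReal_norm, ← ofReal_norm, RCLike.norm_conj, ← norm_stftSchwartz_timeFreqShift]
    _ = ∫⁻ η, ∫⁻ y, ‖stft g F y η‖ₑ * ‖stftSchwartz g γ (y - x, η - ξ)‖ₑ := by
        rw [Measure.volume_eq_prod, lintegral_prod_symm' _ hm]
    _ = _ := by
        rw [← lintegral_sub_left_eq_self _ ξ]
        refine lintegral_congr fun η => ?_
        rw [← lintegral_sub_left_eq_self _ x]
        refine lintegral_congr fun y => ?_
        congr 3
        rw [sub_sub_cancel_left, sub_sub_cancel_left]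

end ChangeOfWindow

/-! ### Moderate weights. -/

section Moderate

variable {V : Type*} [NormedAddCommGroup V]

/-- Weights that are moderate with respect to a polynomial in each variable. -/
structure IsModerate (m : V → V → ℝ) : Prop where
  nonneg : ∀ x ξ, 0 ≤ m x ξ
  continuous : Continuous fun z : V × V => m z.1 z.2
  exists_le : ∃ (N : ℕ) (C : ℝ), 0 ≤ C ∧ ∀ x ξ y η,
    m (x + y) (ξ + η) ≤ m x ξ * (C * ((1 + ‖y‖) ^ N * (1 + ‖η‖) ^ N))

theorem japaneseBracket_nonneg (s : ℝ) (z : V) : 0 ≤ japaneseBracket s z := by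
  rw [japaneseBracket]; positivity

theorem one_le_japaneseBracket {s : ℝ} (hs : 0 ≤ s) (z : V) : 1 ≤ japaneseBracket s z :=
  Real.one_le_rpow (by nlinarith [norm_nonneg z]) (by positivity)

theorem continuous_japaneseBracket (s : ℝ) : Continuous (japaneseBracket s : V → ℝ) := by
  unfold japaneseBracket
  exact Continuous.rpow_const (by fun_prop) fun z => Or.inl (by positivity)

/-- Raise `1 + |a + b|² ≤ 2 (1 + |a|²)(1 + |b|²)` to the power `s/2`. This form gives moderateness.
-/
theorem japaneseBracket_add_le {s : ℝ} (hs : 0 ≤ s) (a b : V) :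
    japaneseBracket s (a + b) ≤ 2 ^ (s / 2) * (japaneseBracket s a * japaneseBracket s b) := by
  simp only [japaneseBracket]
  rw [← Real.mul_rpow (by positivity) (by positivity), ← Real.mul_rpow (by positivity)
    (by positivity)]
  refine Real.rpow_le_rpow (by positivity) ?_ (by positivity)
  have h1 := norm_add_le a b
  have h2 : ‖a + b‖ ^ 2 ≤ (‖a‖ + ‖b‖) ^ 2 := by gcongr
  nlinarith [sq_nonneg (‖a‖ - ‖b‖), mul_nonneg (sq_nonneg ‖a‖) (sq_nonneg ‖b‖), sq_nonneg ‖a‖,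
    sq_nonneg ‖b‖]

/-- The longer vector dominates: `|a + b|` is at most twice its length. The sum on the right,
instead of a product, is what lets the weight fall on one of `f₁`, `f₂` at a time. -/
theorem japaneseBracket_add_le_add {s : ℝ} (hs : 0 ≤ s) (a b : V) :
    japaneseBracket s (a + b) ≤ 2 ^ s * (japaneseBracket s a + japaneseBracket s b) := by
  have key : ∀ a b : V, ‖a‖ ≤ ‖b‖ → japaneseBracket s (a + b) ≤ 2 ^ s * japaneseBracket s b := by
    intro a b hab
    simp only [japaneseBracket]
    rw [show (2 : ℝ) ^ s = (2 ^ 2) ^ (s / 2) by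
      rw [← Real.rpow_natCast, ← Real.rpow_mul (by norm_num)]; congr 1; push_cast; ring,
      ← Real.mul_rpow (by positivity) (by positivity)]
    refine Real.rpow_le_rpow (by positivity) ?_ (by positivity)
    have h1 : ‖a + b‖ ≤ 2 * ‖b‖ := (norm_add_le a b).trans (by linarith)
    have h2 : ‖a + b‖ ^ 2 ≤ (2 * ‖b‖) ^ 2 := by gcongr
    nlinarith
  have hp : (0 : ℝ) < 2 ^ s := by positivity
  rcases le_total ‖a‖ ‖b‖ with h | h
  · refine (key a b h).trans ?_
    gcongr
    linarith [japaneseBracket_nonneg s a]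
  · rw [add_comm]
    refine (key b a h).trans ?_
    gcongr
    linarith [japaneseBracket_nonneg s b]

theorem japaneseBracket_le_pow {s : ℝ} (hs : 0 ≤ s) (z : V) :
    japaneseBracket s z ≤ (1 + ‖z‖) ^ ⌈s⌉₊ := by
  have h1 : (1 : ℝ) ≤ 1 + ‖z‖ := by linarith [norm_nonneg z]
  calc japaneseBracket s z ≤ ((1 + ‖z‖) ^ 2) ^ (s / 2) := by
        rw [japaneseBracket]
        refine Real.rpow_le_rpow (by positivity) ?_ (by positivity)
        nlinarith [norm_nonneg z]
    _ = (1 + ‖z‖) ^ s := by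
        rw [← Real.rpow_natCast, ← Real.rpow_mul (by positivity)]; congr 1; push_cast; ring
    _ ≤ (1 + ‖z‖) ^ (⌈s⌉₊ : ℝ) := Real.rpow_le_rpow_of_exponent_le h1 (Nat.le_ceil s)
    _ = _ := Real.rpow_natCast _ _

theorem isModerate_oneWeight : IsModerate (oneWeight : V → V → ℝ) where
  nonneg _ _ := zero_le_one
  continuous := continuous_const
  exists_le := ⟨0, 1, zero_le_one, by simp [oneWeight]⟩

theorem isModerate_oneTensorWeight {s : ℝ} (hs : 0 ≤ s) :
    IsModerate (oneTensorWeight s : V → V → ℝ) where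
  nonneg _ _ := japaneseBracket_nonneg _ _
  continuous := (continuous_japaneseBracket s).comp continuous_snd
  exists_le := by
    refine ⟨⌈s⌉₊, 2 ^ (s / 2), by positivity, fun x ξ y η => ?_⟩
    have h1 := japaneseBracket_add_le hs ξ η
    have h4 := japaneseBracket_nonneg s ξ
    have h5 : 1 ≤ (1 + ‖y‖) ^ ⌈s⌉₊ := one_le_pow₀ (by linarith [norm_nonneg y])
    have h3 : japaneseBracket s η ≤ (1 + ‖y‖) ^ ⌈s⌉₊ * (1 + ‖η‖) ^ ⌈s⌉₊ :=
      (japaneseBracket_le_pow hs _).trans (le_mul_of_one_le_left (by positivity) h5)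
    calc oneTensorWeight s (x + y) (ξ + η)
        ≤ 2 ^ (s / 2) * (japaneseBracket s ξ * japaneseBracket s η) := h1
      _ ≤ 2 ^ (s / 2) * (japaneseBracket s ξ * ((1 + ‖y‖) ^ ⌈s⌉₊ * (1 + ‖η‖) ^ ⌈s⌉₊)) := by gcongr
      _ = _ := by rw [oneTensorWeight]; ring

theorem isModerate_vWeight {s : ℝ} (hs : 0 ≤ s) : IsModerate (vWeight s : V → V → ℝ) where
  nonneg _ _ := japaneseBracket_nonneg _ _
  continuous := (continuous_japaneseBracket s).comp (WithLp.prod_continuous_toLp 2 V V)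
  exists_le := by
    refine ⟨⌈s⌉₊, 2 ^ (s / 2), by positivity, fun x ξ y η => ?_⟩
    have h1 := japaneseBracket_add_le hs (WithLp.toLp 2 (x, ξ)) (WithLp.toLp 2 (y, η))
    have h2 : ‖WithLp.toLp 2 (y, η)‖ ≤ ‖y‖ + ‖η‖ := by
      rw [WithLp.prod_norm_eq_of_L2]
      refine Real.sqrt_le_iff.2 ⟨by positivity, ?_⟩
      change ‖y‖ ^ 2 + ‖η‖ ^ 2 ≤ _
      nlinarith [norm_nonneg y, norm_nonneg η]
    have h3 : japaneseBracket s (WithLp.toLp 2 (y, η)) ≤ (1 + ‖y‖) ^ ⌈s⌉₊ * (1 + ‖η‖) ^ ⌈s⌉₊ := by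
      refine (japaneseBracket_le_pow hs _).trans ?_
      rw [← mul_pow]
      gcongr
      nlinarith [norm_nonneg y, norm_nonneg η]
    have h4 := japaneseBracket_nonneg s (WithLp.toLp 2 (x, ξ))
    calc vWeight s (x + y) (ξ + η)
        ≤ 2 ^ (s / 2) * (japaneseBracket s (WithLp.toLp 2 (x, ξ)) *
          japaneseBracket s (WithLp.toLp 2 (y, η))) := h1
      _ ≤ 2 ^ (s / 2) * (japaneseBracket s (WithLp.toLp 2 (x, ξ)) *
          ((1 + ‖y‖) ^ ⌈s⌉₊ * (1 + ‖η‖) ^ ⌈s⌉₊)) := by gcongr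
      _ = _ := by rw [vWeight]; ring

end Moderate

/-! ### Change of window and inclusions of modulation spaces. -/

section WindowChange

variable {V : Type*} [NormedAddCommGroup V] [InnerProductSpace ℝ V]

theorem exists_norm_mul_pow_le (S : 𝓢(V × V, ℂ)) (N n : ℕ) : ∃ K : ℝ, 0 ≤ K ∧ ∀ y η,
    ‖S (-y, -η)‖ * ((1 + ‖y‖) ^ N * (1 + ‖η‖) ^ N)
      ≤ K * ((1 + ‖y‖) ^ (-n : ℝ) * (1 + ‖η‖) ^ (-n : ℝ)) := by
  refine ⟨2 ^ (2 * (N + n)) * ((Finset.Iic (2 * (N + n), 0)).sup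
    fun m => SchwartzMap.seminorm ℂ (E := V × V) (F := ℂ) m.1 m.2) S, by positivity, fun y η => ?_⟩
  have h := SchwartzMap.one_add_le_sup_seminorm_apply (𝕜 := ℂ) (m := (2 * (N + n), 0))
    (k := 2 * (N + n)) (n := 0) le_rfl le_rfl S (-y, -η)
  rw [norm_iteratedFDeriv_zero] at h
  set K := 2 ^ (2 * (N + n)) * ((Finset.Iic (2 * (N + n), 0)).sup
    fun m => SchwartzMap.seminorm ℂ (E := V × V) (F := ℂ) m.1 m.2) S
  have hy : ‖y‖ ≤ ‖((-y, -η) : V × V)‖ := by simp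
  have hη : ‖η‖ ≤ ‖((-y, -η) : V × V)‖ := by simp
  have h1 : (1 + ‖y‖) ^ (N + n) * (1 + ‖η‖) ^ (N + n)
      ≤ (1 + ‖((-y, -η) : V × V)‖) ^ (2 * (N + n)) := by
    rw [two_mul, pow_add _ (N + n)]
    gcongr
  rw [Real.rpow_neg (by positivity), Real.rpow_neg (by positivity), Real.rpow_natCast,
    Real.rpow_natCast, ← mul_inv, ← div_eq_mul_inv, le_div_iff₀ (by positivity)]
  calc ‖S (-y, -η)‖ * ((1 + ‖y‖) ^ N * (1 + ‖η‖) ^ N) * ((1 + ‖y‖) ^ n * (1 + ‖η‖) ^ n)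
      = ((1 + ‖y‖) ^ (N + n) * (1 + ‖η‖) ^ (N + n)) * ‖S (-y, -η)‖ := by ring
    _ ≤ (1 + ‖((-y, -η) : V × V)‖) ^ (2 * (N + n)) * ‖S (-y, -η)‖ := by gcongr
    _ ≤ K := h

variable [FiniteDimensional ℝ V] [MeasurableSpace V] [BorelSpace V]

/-- Schwartz decay beats the polynomial with a power `-n` to spare in each variable, and `n` is
chosen large enough for `(1 + |·|)^{-n}` to lie in both `L^p` and `L^q`. -/
theorem eLpNorm_eLpNorm_schwartz_lt_top (S : 𝓢(V × V, ℂ)) (N : ℕ) (p q : ℝ≥0∞) :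
    eLpNorm (fun η => eLpNorm (fun y =>
      ‖S (-y, -η)‖ * ((1 + ‖y‖) ^ N * (1 + ‖η‖) ^ N)) p volume) q (volume : Measure V) < ∞ := by
  obtain ⟨k, hk⟩ := Measure.HasTemperateGrowth.exists_eLpNorm_lt_top p
    (μ := (volume : Measure V)) inferInstance
  obtain ⟨l, hl⟩ := Measure.HasTemperateGrowth.exists_eLpNorm_lt_top q
    (μ := (volume : Measure V)) inferInstance
  have mono : ∀ {j : ℕ} {r : ℝ≥0∞}, j ≤ max k l →
      eLpNorm (fun x : V => (1 + ‖x‖) ^ (-j : ℝ)) r volume < ∞ →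
      eLpNorm (fun x : V => (1 + ‖x‖) ^ (-(max k l : ℕ) : ℝ)) r volume < ∞ := by
    intro j r hj h
    refine (eLpNorm_mono_real fun x => ?_).trans_lt h
    rw [Real.norm_of_nonneg (by positivity)]
    refine Real.rpow_le_rpow_of_exponent_le (by linarith [norm_nonneg x]) ?_
    exact neg_le_neg (by exact_mod_cast hj)
  have hk' := mono (le_max_left k l) hk
  have hl' := mono (le_max_right k l) hl
  set n := max k l
  obtain ⟨K, hK, h⟩ := exists_norm_mul_pow_le S N n
  set M := eLpNorm (fun x : V => (1 + ‖x‖) ^ (-n : ℝ)) p volume with hM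
  have h1 : ∀ η, eLpNorm (fun y => ‖S (-y, -η)‖ * ((1 + ‖y‖) ^ N * (1 + ‖η‖) ^ N)) p volume
      ≤ ‖(K * M.toReal) • (1 + ‖η‖) ^ (-n : ℝ)‖ₑ := by
    intro η
    calc _ ≤ eLpNorm ((K * (1 + ‖η‖) ^ (-n : ℝ)) • fun y : V => (1 + ‖y‖) ^ (-n : ℝ)) p volume := by
          refine eLpNorm_mono_real fun y => ?_
          rw [Real.norm_of_nonneg (by positivity)]
          refine (h y η).trans_eq ?_
          simp only [Pi.smul_apply, smul_eq_mul]
          ring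
      _ = ‖K * (1 + ‖η‖) ^ (-n : ℝ)‖ₑ * M := eLpNorm_const_smul _ _ _ _
      _ = ‖K * (1 + ‖η‖) ^ (-n : ℝ)‖ₑ * ‖M.toReal‖ₑ := by
          congr 1
          rw [Real.enorm_of_nonneg ENNReal.toReal_nonneg, ENNReal.ofReal_toReal hk'.ne]
      _ = _ := by rw [← enorm_mul, smul_eq_mul]; congr 1; ring
  calc _ ≤ eLpNorm (fun η : V => ‖(K * M.toReal) • (1 + ‖η‖) ^ (-n : ℝ)‖ₑ) q volume :=
        eLpNorm_mono_enorm fun η => by simpa only [enorm_eq_self] using h1 η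
    _ = ‖K * M.toReal‖ₑ * eLpNorm (fun η : V => (1 + ‖η‖) ^ (-n : ℝ)) q volume := by
        rw [eLpNorm_enorm]
        exact eLpNorm_const_smul (K * M.toReal) (fun η : V => (1 + ‖η‖) ^ (-n : ℝ)) q volume
    _ < ∞ := ENNReal.mul_lt_top enorm_lt_top hl'

/-- The exponent that the convolution kernel must have for Young's inequality to raise `p` to `p'`.
-/
theorem young_exponent {p p' : ℝ≥0∞} (hp : 1 ≤ p) (hpp : p ≤ p') :
    1 ≤ (1 + p'⁻¹ - p⁻¹)⁻¹ ∧ p⁻¹ + (1 + p'⁻¹ - p⁻¹)⁻¹⁻¹ = 1 + p'⁻¹ := by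
  have h1 : p⁻¹ ≤ 1 := ENNReal.inv_le_one.2 hp
  have h2 : p'⁻¹ ≤ p⁻¹ := ENNReal.inv_le_inv.2 hpp
  refine ⟨ENNReal.one_le_inv.2 ?_, ?_⟩
  · rw [tsub_le_iff_right]; gcongr
  · rw [inv_inv, add_tsub_cancel_of_le (h1.trans le_self_add)]

/-- Modulation norms with different windows: the exponents may increase. This contains both the
inclusion relations of modulation spaces and the independence of the window. -/
theorem exists_modulationNorm_le {g : 𝓢(V, ℂ)} (hg : g ≠ 0) (γ : 𝓢(V, ℂ)) {m : V → V → ℝ}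
    (hm : IsModerate m) {p p' q q' : ℝ≥0∞} (hp : 1 ≤ p) (hpp : p ≤ p') (hq : 1 ≤ q)
    (hqq : q ≤ q') :
    ∃ K : ℝ≥0, ∀ F : 𝓢'(V, ℂ), modulationNorm γ p' q' m F ≤ K * modulationNorm g p q m F := by
  obtain ⟨N, C, hC, hmod⟩ := hm.exists_le
  have hpos := integral_norm_sq_pos hg
  set D := ∫ u, ‖g u‖ ^ 2 with hD
  obtain ⟨hr, hr'⟩ := young_exponent hp hpp
  obtain ⟨ht, ht'⟩ := young_exponent hq hqq
  set r := (1 + p'⁻¹ - p⁻¹)⁻¹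
  set t := (1 + q'⁻¹ - q⁻¹)⁻¹
  -- The kernel absorbs the normalisation `1/D`, the moderateness constant and the polynomial growth
  -- of the weight; as a Schwartz function times a polynomial it has finite mixed norm for every
  -- pair of exponents.
  let B : V → V → ℝ≥0∞ := fun y η =>
    ‖((D⁻¹ * C : ℝ) : ℂ) • (stftSchwartz g γ) (-y, -η)‖ₑ
      * ENNReal.ofReal ((1 + ‖y‖) ^ N * (1 + ‖η‖) ^ N)
  have hBm : Measurable (Function.uncurry B) := by
    have hS : Continuous fun z : V × V => ((D⁻¹ * C : ℝ) : ℂ) • (stftSchwartz g γ) (-z) :=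
      Continuous.fun_const_smul ((stftSchwartz g γ).continuous.comp continuous_neg) _
    have hw : Continuous fun z : V × V => (1 + ‖z.1‖) ^ N * (1 + ‖z.2‖) ^ N := by fun_prop
    have h1 : Measurable fun z : V × V => ‖((D⁻¹ * C : ℝ) : ℂ) • (stftSchwartz g γ) (-z)‖ₑ :=
      hS.measurable.enorm
    have h2 : Measurable fun z : V × V => ENNReal.ofReal ((1 + ‖z.1‖) ^ N * (1 + ‖z.2‖) ^ N) :=
      ENNReal.measurable_ofReal.comp hw.measurable
    exact h1.mul h2
  have hB : eLpNorm (fun η => eLpNorm (fun y => B y η) r volume) t volume < ∞ := by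
    refine lt_of_eq_of_lt ?_ (eLpNorm_eLpNorm_schwartz_lt_top
      (((D⁻¹ * C : ℝ) : ℂ) • stftSchwartz g γ) N r t)
    congr 1
    ext η
    refine eLpNorm_congr_enorm_ae (Filter.Eventually.of_forall fun y => ?_)
    simp only [B, enorm_eq_self, _root_.smul_apply]
    rw [enorm_mul, enorm_norm, ← Real.enorm_of_nonneg (by positivity)]
  refine ⟨(eLpNorm (fun η => eLpNorm (fun y => B y η) r volume) t volume).toNNReal, fun F => ?_⟩
  rw [ENNReal.coe_toNNReal hB.ne, mul_comm]
  let A : V → V → ℝ≥0∞ := fun x ξ => ‖stft g F x ξ * (m x ξ : ℂ)‖ₑ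
  have hAm : Measurable (Function.uncurry A) :=
    ((continuous_stft g F).mul (Complex.continuous_ofReal.comp hm.continuous)).measurable.enorm
  have young := eLpNorm_eLpNorm_convolution_le (μ := (volume : Measure V))
    (ν := (volume : Measure V)) hp hr (hp.trans hpp) hq ht hr' ht' hAm hBm
  have hA : eLpNorm (fun ξ => eLpNorm (fun x => A x ξ) p volume) q volume
      = modulationNorm g p q m F := by
    simp only [A, eLpNorm_enorm]
    rfl
  rw [hA] at young
  refine le_trans ?_ young
  refine eLpNorm_mono_enorm fun ξ => ?_
  simp only [enorm_eq_self]
  refine eLpNorm_mono_enorm fun x => ?_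
  have hD0 : ENNReal.ofReal D ≠ 0 := by simpa using hpos
  have hDt : ENNReal.ofReal D ≠ ∞ := ENNReal.ofReal_ne_top
  have h1 := enorm_stft_le g γ F x ξ
  rw [← hD] at h1
  have h2 : ‖stft γ F x ξ‖ₑ ≤ (ENNReal.ofReal D)⁻¹ *
      ∫⁻ η, ∫⁻ y, ‖stft g F (x - y) (ξ - η)‖ₑ * ‖stftSchwartz g γ (-y, -η)‖ₑ := by
    calc ‖stft γ F x ξ‖ₑ = (ENNReal.ofReal D)⁻¹ * (ENNReal.ofReal D * ‖stft γ F x ξ‖ₑ) := by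
          rw [← mul_assoc, ENNReal.inv_mul_cancel hD0 hDt, one_mul]
      _ ≤ _ := by gcongr
  rw [enorm_mul, enorm_eq_self]
  have hmx : ‖(m x ξ : ℂ)‖ₑ = ENNReal.ofReal (m x ξ) := by
    rw [← ofReal_norm, Complex.norm_real, Real.norm_of_nonneg (hm.nonneg _ _)]
  calc ‖stft γ F x ξ‖ₑ * ‖(m x ξ : ℂ)‖ₑ
      ≤ ((ENNReal.ofReal D)⁻¹ * ENNReal.ofReal (m x ξ)) *
        ∫⁻ η, ∫⁻ y, ‖stft g F (x - y) (ξ - η)‖ₑ * ‖stftSchwartz g γ (-y, -η)‖ₑ := by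
        rw [hmx]
        refine (mul_le_mul_left h2 _).trans_eq ?_
        ring
    _ = ∫⁻ η, ∫⁻ y, ((ENNReal.ofReal D)⁻¹ * ENNReal.ofReal (m x ξ)) *
          (‖stft g F (x - y) (ξ - η)‖ₑ * ‖stftSchwartz g γ (-y, -η)‖ₑ) := by
        have hfin : (ENNReal.ofReal D)⁻¹ * ENNReal.ofReal (m x ξ) ≠ ∞ :=
          ENNReal.mul_ne_top (ENNReal.inv_ne_top.2 hD0) ENNReal.ofReal_ne_top
        rw [← lintegral_const_mul' _ _ hfin]
        refine lintegral_congr fun η => ?_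
        rw [← lintegral_const_mul' _ _ hfin]
    _ ≤ ∫⁻ η, ∫⁻ y, A (x - y) (ξ - η) * B y η := by
        refine lintegral_mono fun η => lintegral_mono fun y => ?_
        simp only [A, B]
        -- Moderateness moves the weight from `(x, ξ)` to `(x - y, ξ - η)` at the price of the
        -- polynomial factor in `B`.
        have h3 := hmod (x - y) (ξ - η) y η
        rw [sub_add_cancel, sub_add_cancel] at h3
        rw [enorm_mul, enorm_smul, ← ENNReal.ofReal_inv_of_pos hpos]
        have e1 : ‖(m (x - y) (ξ - η) : ℂ)‖ₑ = ENNReal.ofReal (m (x - y) (ξ - η)) := by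
          rw [← ofReal_norm, Complex.norm_real, Real.norm_of_nonneg (hm.nonneg _ _)]
        have e2 : ‖((D⁻¹ * C : ℝ) : ℂ)‖ₑ = ENNReal.ofReal D⁻¹ * ENNReal.ofReal C := by
          rw [← ofReal_norm, Complex.norm_real, Real.norm_of_nonneg (by positivity),
            ENNReal.ofReal_mul (by positivity)]
        have h4 : ENNReal.ofReal (m x ξ) ≤ ENNReal.ofReal (m (x - y) (ξ - η)) *
            (ENNReal.ofReal C * ENNReal.ofReal ((1 + ‖y‖) ^ N * (1 + ‖η‖) ^ N)) := by
          rw [← ENNReal.ofReal_mul hC, ← ENNReal.ofReal_mul (hm.nonneg _ _)]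
          exact ENNReal.ofReal_le_ofReal h3
        rw [e1, e2]
        calc _ ≤ ENNReal.ofReal D⁻¹ * (ENNReal.ofReal (m (x - y) (ξ - η)) *
            (ENNReal.ofReal C * ENNReal.ofReal ((1 + ‖y‖) ^ N * (1 + ‖η‖) ^ N))) *
            (‖stft g F (x - y) (ξ - η)‖ₑ * ‖stftSchwartz g γ (-y, -η)‖ₑ) := by gcongr
          _ = _ := by ring

end WindowChange

/-! ### The short-time Fourier transform of a cross-Wigner distribution. -/

section WignerWindow

variable {E : Type*} [NormedAddCommGroup E] [InnerProductSpace ℝ E]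

theorem character_toLp (ζ : WithLp 2 (E × E)) (x ξ : E) :
    character ζ (WithLp.toLp 2 (x, ξ)) = character ζ.fst x * character ζ.snd ξ := by
  have h : inner ℝ ζ (WithLp.toLp 2 (x, ξ)) = inner ℝ ζ.fst x + inner ℝ ζ.snd ξ :=
    WithLp.prod_inner_apply _ _
  simp only [character, h, ← Complex.exp_add]
  congr 1
  push_cast
  ring

/-- When the pairings are expanded, every term is linear in `u` or in `v`, except the pairing of
`z₂` with `ζ₂`, which gives the constant phase. -/
theorem character_wigner_phase (z₂ ζ₁ ζ₂ u v : E) :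
    character (-z₂) (u - v) * character (-ζ₁) ((2⁻¹ : ℝ) • (u + v)) * character (-ζ₂) z₂
      = character (-z₂) ζ₂ * character (-(z₂ + (2⁻¹ : ℝ) • ζ₁)) u
        * character (z₂ - (2⁻¹ : ℝ) • ζ₁) v := by
  simp only [character, ← Complex.exp_add]
  congr 1
  simp only [inner_neg_left, inner_sub_left, inner_sub_right, inner_add_left, inner_add_right,
    real_inner_smul_left, real_inner_smul_right]
  rw [real_inner_comm z₂ ζ₂]
  push_cast
  ring

variable [FiniteDimensional ℝ E]

/-- The function `(x, t) ↦ g(x + t/2) conj(g(x - t/2))`. -/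
def instCorrelation (g : 𝓢(E, ℂ)) : 𝓢(E × E, ℂ) :=
  compCLMOfContinuousLinearEquiv ℂ wignerCoord.symm (tensorSchwartz g (conjSchwartz g))

theorem instCorrelation_apply (g : 𝓢(E, ℂ)) (x t : E) :
    instCorrelation g (x, t)
      = g (x + (2⁻¹ : ℝ) • t) * starRingEnd ℂ (g (x - (2⁻¹ : ℝ) • t)) := rfl

variable [MeasurableSpace E] [BorelSpace E]

/-- The Wigner distribution of the Schwartz function `g`, as a Schwartz function. -/
def wignerWindow (g : 𝓢(E, ℂ)) : 𝓢(WithLp 2 (E × E), ℂ) :=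
  compCLMOfContinuousLinearEquiv ℂ (WithLp.prodContinuousLinearEquiv 2 ℝ E E)
    (partialFourier (instCorrelation g))

theorem wignerWindow_apply (g : 𝓢(E, ℂ)) (z : WithLp 2 (E × E)) :
    wignerWindow g z = partialFourier (instCorrelation g) (z.fst, z.snd) := rfl

/-- Fourier inversion recovers the correlation `g(x + t/2) conj(g(x - t/2))`, which at `t = 0` is
`|g(x)|²`. -/
theorem wignerWindow_ne_zero {g : 𝓢(E, ℂ)} (hg : g ≠ 0) : wignerWindow g ≠ 0 := by
  intro h
  refine hg (SchwartzMap.ext fun x => ?_)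
  have h1 := integral_character_mul_partialFourier (instCorrelation g) x 0
  have h2 : ∀ ξ, partialFourier (instCorrelation g) (x, ξ) = 0 := fun ξ => by
    have := congrArg (fun f : 𝓢(WithLp 2 (E × E), ℂ) => f (WithLp.toLp 2 (x, ξ))) h
    simpa [wignerWindow_apply] using this
  simp_rw [h2] at h1
  simpa [instCorrelation_apply] using h1.symm

/-- The reason for the choice of window: on a time-frequency shift of `W(g, g)` the transposed
operator undoes the partial Fourier transform, and what remains is a tensor product of
time-frequency shifts of `g`, the first one conjugated. -/
theorem wignerTranspose_conj_timeFreqShift (g : 𝓢(E, ℂ)) (z ζ : WithLp 2 (E × E)) (u v : E) :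
    wignerTranspose (conjSchwartz (timeFreqShift z ζ (wignerWindow g))) (u, v)
      = character (-z.snd) ζ.snd
        * conjSchwartz (timeFreqShift (z.fst - (2⁻¹ : ℝ) • ζ.snd)
          (z.snd + (2⁻¹ : ℝ) • ζ.fst) g) u
        * timeFreqShift (z.fst + (2⁻¹ : ℝ) • ζ.snd) (z.snd - (2⁻¹ : ℝ) • ζ.fst) g v := by
  set x := (2⁻¹ : ℝ) • (u + v) with hx
  have h0 : wignerTranspose (conjSchwartz (timeFreqShift z ζ (wignerWindow g))) (u, v)
      = ∫ ξ, character (-ξ) (u - v)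
        * conjSchwartz (timeFreqShift z ζ (wignerWindow g)) (WithLp.toLp 2 (x, ξ)) :=
    partialFourier_eq_integral_character _ _ _
  -- After the translation `ξ ↦ ξ + z₂` the integrand is a constant phase times the conjugate of a
  -- Fourier inversion integrand at the point `u - v + ζ₂`.
  have h1 : ∀ ξ, character (-(ξ + z.snd)) (u - v) * conjSchwartz (timeFreqShift z ζ (wignerWindow g))
        (WithLp.toLp 2 (x, ξ + z.snd))
      = (character (-z.snd) (u - v) * character (-ζ.fst) x * character (-ζ.snd) z.snd)
        * starRingEnd ℂ (character ξ (u - v + ζ.snd)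
          * partialFourier (instCorrelation g) (x - z.fst, ξ)) := by
    intro ξ
    have e : wignerWindow g (WithLp.toLp 2 (x, ξ + z.snd) - z)
        = partialFourier (instCorrelation g) (x - z.fst, ξ) := by
      rw [wignerWindow_apply]
      congr 2
      simp
    rw [conjSchwartz_apply, timeFreqShift_apply, e, character_toLp]
    simp only [map_mul, conj_character]
    rw [neg_add, character_add_left, character_add_right (-ζ.snd), character_add_right (-ξ),
      character_comm (-ξ) ζ.snd, character_neg_right]
    ring
  rw [h0, ← integral_add_right_eq_self _ z.snd]
  simp_rw [h1]
  rw [integral_const_mul, integral_conj, integral_character_mul_partialFourier,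
    character_wigner_phase, instCorrelation_apply]
  have e1 : x - z.fst + (2⁻¹ : ℝ) • (u - v + ζ.snd) = u - (z.fst - (2⁻¹ : ℝ) • ζ.snd) := by
    rw [hx]; module
  have e2 : x - z.fst - (2⁻¹ : ℝ) • (u - v + ζ.snd) = v - (z.fst + (2⁻¹ : ℝ) • ζ.snd) := by
    rw [hx]; module
  rw [e1, e2]
  simp only [conjSchwartz_apply, timeFreqShift_apply, map_mul, conj_character, Complex.conj_conj]
  ring

/-- The short-time Fourier transform of a cross-Wigner distribution. -/
theorem stft_crossWigner (g : 𝓢(E, ℂ)) (f₁ f₂ : 𝓢'(E, ℂ)) (z ζ : WithLp 2 (E × E)) :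
    stft (wignerWindow g) (crossWigner f₁ f₂) z ζ
      = character (-z.snd) ζ.snd
        * stft g f₁ (z.fst - (2⁻¹ : ℝ) • ζ.snd) (z.snd + (2⁻¹ : ℝ) • ζ.fst)
        * starRingEnd ℂ (stft g f₂ (z.fst + (2⁻¹ : ℝ) • ζ.snd) (z.snd - (2⁻¹ : ℝ) • ζ.fst)) := by
  set a := timeFreqShift (z.fst - (2⁻¹ : ℝ) • ζ.snd) (z.snd + (2⁻¹ : ℝ) • ζ.fst) g with ha
  set b := timeFreqShift (z.fst + (2⁻¹ : ℝ) • ζ.snd) (z.snd - (2⁻¹ : ℝ) • ζ.fst) g with hb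
  -- The test function separates in `u` and `v`, so the two distributions act independently, each
  -- giving a short-time Fourier transform.
  have h1 : ∀ u, sliceCLM u (wignerTranspose (conjSchwartz (timeFreqShift z ζ (wignerWindow g))))
      = (character (-z.snd) ζ.snd * conjSchwartz a u) • b := by
    intro u
    ext v
    rw [sliceCLM_apply, wignerTranspose_conj_timeFreqShift]
    rfl
  have h2 : contractSnd (conjDistrib f₂)
        (wignerTranspose (conjSchwartz (timeFreqShift z ζ (wignerWindow g))))
      = (character (-z.snd) ζ.snd * starRingEnd ℂ (f₂ (conjSchwartz b))) • conjSchwartz a := by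
    ext u
    rw [contractSnd_apply, h1, map_smul, conjDistrib_apply, smul_eq_mul, _root_.smul_apply,
      smul_eq_mul]
    ring
  rw [stft, crossWigner_apply, tensorDistrib_apply, h2, map_smul, smul_eq_mul, stft, stft]
  ring

theorem enorm_stft_crossWigner (g : 𝓢(E, ℂ)) (f₁ f₂ : 𝓢'(E, ℂ)) (z ζ : WithLp 2 (E × E)) :
    ‖stft (wignerWindow g) (crossWigner f₁ f₂) z ζ‖ₑ
      = ‖stft g f₁ (z.fst - (2⁻¹ : ℝ) • ζ.snd) (z.snd + (2⁻¹ : ℝ) • ζ.fst)‖ₑ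
        * ‖stft g f₂ (z.fst + (2⁻¹ : ℝ) • ζ.snd) (z.snd - (2⁻¹ : ℝ) • ζ.fst)‖ₑ := by
  rw [stft_crossWigner, enorm_mul, enorm_mul, ← ofReal_norm (character _ _), norm_character,
    ENNReal.ofReal_one, one_mul, ← ofReal_norm (starRingEnd ℂ _), RCLike.norm_conj, ofReal_norm]

end WignerWindow

/-! ### Norms on products as iterated norms. -/

section ProductNorm

theorem eLpNorm_top_le_iff {γ : Type*} [MeasurableSpace γ] {κ : Measure γ} {h : γ → ℝ≥0∞}
    {c : ℝ≥0∞} : eLpNorm h ∞ κ ≤ c ↔ ∀ᵐ x ∂κ, h x ≤ c := by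
  rw [eLpNorm_exponent_top, eLpNormEssSup_eq_essSup_enorm]
  simp only [enorm_eq_self]
  exact ⟨fun hc => (ae_le_essSup (μ := κ) (f := h)).mono fun x hx => hx.trans hc,
    essSup_le_of_ae_le c⟩

variable {α β : Type*} [MeasurableSpace α] [MeasurableSpace β] {μ : Measure α} {ν : Measure β}
  [SFinite μ] [SFinite ν]

/-- Tonelli for finite `p`. For `p = ∞` the two sides have the same upper bounds `c`, by Fubini for
null sets. -/
theorem eLpNorm_prod_eq {f : α → β → ℝ≥0∞} (hf : Measurable (Function.uncurry f)) (p : ℝ≥0∞) :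
    eLpNorm (fun z : α × β => f z.1 z.2) p (μ.prod ν)
      = eLpNorm (fun y => eLpNorm (fun x => f x y) p μ) p ν := by
  rcases eq_or_ne p 0 with rfl | h0
  · simp
  rcases eq_or_ne p ∞ with rfl | ht
  · have hae : ∀ c : ℝ≥0∞, (∀ᵐ z ∂μ.prod ν, f z.1 z.2 ≤ c) ↔ ∀ᵐ y ∂ν, ∀ᵐ x ∂μ, f x y ≤ c := by
      intro c
      have hs : MeasurableSet {z : α × β | f z.1 z.2 ≤ c} := measurableSet_le hf measurable_const
      rw [Measure.ae_prod_iff_ae_ae hs]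
      exact Measure.ae_ae_comm hs
    refine eq_of_forall_ge_iff fun c => ?_
    simp only [eLpNorm_top_le_iff]
    exact hae c
  · rw [eLpNorm_eq_lintegral_rpow_enorm_toReal h0 ht, eLpNorm_eq_lintegral_rpow_enorm_toReal h0 ht]
    simp only [enorm_eq_self, eLpNorm_rpow_toReal_eq_lintegral h0 ht]
    rw [lintegral_prod_symm' (fun z : α × β => f z.1 z.2 ^ p.toReal) (hf.pow_const _)]

end ProductNorm

/-! ### The unweighted bilinear estimate. -/

section Bilinear

variable {E : Type*} [NormedAddCommGroup E] [InnerProductSpace ℝ E] [FiniteDimensional ℝ E]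
  [MeasurableSpace E] [BorelSpace E]

theorem eLpNorm_withLp_eq {f : E → E → ℝ≥0∞} (hf : Measurable (Function.uncurry f)) (p : ℝ≥0∞) :
    eLpNorm (fun z : WithLp 2 (E × E) => f z.fst z.snd) p volume
      = eLpNorm (fun y => eLpNorm (fun x => f x y) p volume) p (volume : Measure E) := by
  rw [← eLpNorm_prod_eq hf]
  exact eLpNorm_comp_measurePreserving (g := fun z : E × E => f z.1 z.2)
    hf.aestronglyMeasurable (WithLp.volume_preserving_ofLp E E)

theorem eLpNorm_withLp_swap_eq {f : E → E → ℝ≥0∞} (hf : Measurable (Function.uncurry f))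
    (p : ℝ≥0∞) :
    eLpNorm (fun z : WithLp 2 (E × E) => f z.snd z.fst) p volume
      = eLpNorm (fun y => eLpNorm (fun x => f x y) p volume) p (volume : Measure E) := by
  rw [← eLpNorm_prod_eq hf]
  have hs : MeasurePreserving (Prod.swap : E × E → E × E) (volume.prod volume)
      (volume.prod volume) := Measure.measurePreserving_swap
  have h1 := eLpNorm_comp_measurePreserving (p := p) (g := fun z : E × E => f z.1 z.2)
    hf.aestronglyMeasurable hs
  have h2 := eLpNorm_comp_measurePreserving (p := p) (g := fun z : E × E => f z.2 z.1)
    (hf.comp measurable_swap).aestronglyMeasurable (WithLp.volume_preserving_ofLp E E)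
  exact h2.trans h1

theorem eLpNorm_shift_eq (f : E → E → ℝ≥0∞) (hf : Measurable (Function.uncurry f)) (p : ℝ≥0∞)
    (a b : E) :
    eLpNorm (fun z : WithLp 2 (E × E) => f (z.fst + a) (z.snd + b)) p volume
      = eLpNorm (fun z : WithLp 2 (E × E) => f z.fst z.snd) p volume := by
  have hm : Measurable fun z : WithLp 2 (E × E) => f z.fst z.snd :=
    hf.comp (WithLp.volume_preserving_ofLp E E).measurable
  have hmp : MeasurePreserving (fun z : WithLp 2 (E × E) => z + WithLp.toLp 2 (a, b))
      volume volume := measurePreserving_add_right _ _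
  have h := eLpNorm_comp_measurePreserving (p := p)
    (g := fun z : WithLp 2 (E × E) => f z.fst z.snd) hm.aestronglyMeasurable hmp
  simpa only [Function.comp_def, WithLp.add_fst, WithLp.add_snd, WithLp.toLp_fst,
    WithLp.toLp_snd] using h

/-- The identity `‖h^p‖_{r/p} = ‖h‖_r^p`, used for the inner and then for the outer norm. -/
theorem mixed_rpow {f : E → E → ℝ≥0∞} {p : ℝ≥0∞} (h0 : p ≠ 0) (ht : p ≠ ∞) (r t : ℝ≥0∞) :
    eLpNorm (fun ξ => eLpNorm (fun x => f x ξ ^ p.toReal) (r / p) volume) (t / p)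
        (volume : Measure E)
      = eLpNorm (fun ξ => eLpNorm (fun x => f x ξ) r volume) t (volume : Measure E) ^ p.toReal := by
  have hpos := ENNReal.toReal_pos h0 ht
  have e : ∀ r : ℝ≥0∞, r / p * ENNReal.ofReal p.toReal = r := fun r => by
    rw [ENNReal.ofReal_toReal ht, ENNReal.div_mul_cancel h0 ht]
  have h1 : ∀ ξ, eLpNorm (fun x => f x ξ ^ p.toReal) (r / p) volume
      = eLpNorm (fun x => f x ξ) r volume ^ p.toReal := fun ξ => by
    have := eLpNorm_enorm_rpow (μ := (volume : Measure E)) (p := r / p) (fun x => f x ξ) hpos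
    simpa only [enorm_eq_self, e] using this
  simp_rw [h1]
  have := eLpNorm_enorm_rpow (μ := (volume : Measure E)) (p := t / p)
    (fun ξ => eLpNorm (fun x => f x ξ) r volume) hpos
  simpa only [enorm_eq_self, e] using this

theorem mixed_neg_left {f : E → E → ℝ≥0∞} (hf : Measurable (Function.uncurry f)) (r t : ℝ≥0∞) :
    eLpNorm (fun ξ => eLpNorm (fun x => f (-x) ξ) r volume) t (volume : Measure E)
      = eLpNorm (fun ξ => eLpNorm (fun x => f x ξ) r volume) t (volume : Measure E) := by
  congr 1
  ext ξ
  have hm : Measurable fun x => f x ξ := hf.comp measurable_prodMk_right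
  exact eLpNorm_comp_measurePreserving (g := fun x => f x ξ) hm.aestronglyMeasurable
    (Measure.measurePreserving_neg volume)

theorem mixed_neg_right {f : E → E → ℝ≥0∞} (hf : Measurable (Function.uncurry f)) (r t : ℝ≥0∞) :
    eLpNorm (fun ξ => eLpNorm (fun x => f x (-ξ)) r volume) t (volume : Measure E)
      = eLpNorm (fun ξ => eLpNorm (fun x => f x ξ) r volume) t (volume : Measure E) :=
  eLpNorm_comp_measurePreserving (g := fun ξ => eLpNorm (fun x => f x ξ) r volume)
    (measurable_eLpNorm_left hf r).aestronglyMeasurable (Measure.measurePreserving_neg volume)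

theorem eLpNorm_top_mul_le {α : Type*} [MeasurableSpace α] {μ : Measure α} (f g : α → ℝ≥0∞) :
    eLpNorm (fun x => f x * g x) ∞ μ ≤ eLpNorm f ∞ μ * eLpNorm g ∞ μ := by
  simp only [eLpNorm_exponent_top, eLpNormEssSup_eq_essSup_enorm, enorm_eq_self]
  refine essSup_le_of_ae_le _ ?_
  filter_upwards [ae_le_essSup (μ := μ) (f := f), ae_le_essSup (μ := μ) (f := g)] with x h1 h2
  gcongr

theorem young_exponent_div {p q p₁ p₂ : ℝ≥0∞} (h0 : p ≠ 0) (ht : p ≠ ∞)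
    (h : p₁⁻¹ + p₂⁻¹ = p⁻¹ + q⁻¹) : (p₁ / p)⁻¹ + (p₂ / p)⁻¹ = 1 + (q / p)⁻¹ := by
  have e : ∀ r : ℝ≥0∞, (r / p)⁻¹ = p * r⁻¹ := fun r => by
    rw [ENNReal.inv_div (Or.inl ht) (Or.inl h0), div_eq_mul_inv]
  rw [e, e, e, ← mul_add, h, mul_add, ENNReal.mul_inv_cancel h0 ht]

/-- The bilinear estimate behind the boundedness of the Wigner distribution. -/
theorem eLpNorm_eLpNorm_wigner_le {p q p₁ p₂ q₁ q₂ : ℝ≥0∞} (hp : 1 ≤ p) (hpq : p ≤ q)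
    (hp₁ : p ≤ p₁) (hp₂ : p ≤ p₂) (hq₁ : p ≤ q₁) (hq₂ : p ≤ q₂)
    (hpp : p₁⁻¹ + p₂⁻¹ = p⁻¹ + q⁻¹) (hqq : q₁⁻¹ + q₂⁻¹ = p⁻¹ + q⁻¹) {A B : E → E → ℝ≥0∞}
    (hA : Measurable (Function.uncurry A)) (hB : Measurable (Function.uncurry B)) :
    eLpNorm (fun ζ : WithLp 2 (E × E) => eLpNorm (fun z : WithLp 2 (E × E) =>
        A (z.fst - (2⁻¹ : ℝ) • ζ.snd) (z.snd + (2⁻¹ : ℝ) • ζ.fst)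
          * B (z.fst + (2⁻¹ : ℝ) • ζ.snd) (z.snd - (2⁻¹ : ℝ) • ζ.fst)) p volume) q volume
      ≤ eLpNorm (fun ξ => eLpNorm (fun x => A x ξ) p₁ volume) q₁ volume
        * eLpNorm (fun ξ => eLpNorm (fun x => B x ξ) p₂ volume) q₂ volume := by
  have h0 : p ≠ 0 := (zero_lt_one.trans_le hp).ne'
  rcases eq_or_ne p ∞ with rfl | ht
  -- All exponents are infinite here, and translation invariance of the sup norm suffices.
  · obtain rfl := top_le_iff.1 hpq
    obtain rfl := top_le_iff.1 hp₁
    obtain rfl := top_le_iff.1 hp₂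
    obtain rfl := top_le_iff.1 hq₁
    obtain rfl := top_le_iff.1 hq₂
    rw [eLpNorm_exponent_top, eLpNormEssSup_eq_essSup_enorm]
    refine essSup_le_of_ae_le _ (Filter.Eventually.of_forall fun ζ => ?_)
    simp only [enorm_eq_self]
    refine (eLpNorm_top_mul_le _ _).trans_eq ?_
    simp only [sub_eq_add_neg]
    rw [eLpNorm_shift_eq A hA, eLpNorm_shift_eq B hB, eLpNorm_withLp_eq hA, eLpNorm_withLp_eq hB]
  have hpos := ENNReal.toReal_pos h0 ht
  set s := p.toReal with hs
  -- The reflections turn the correlation of `A^p` and `B^p` into a convolution evaluated at `(ζ₂,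
  -- ζ₁)`; they do not change mixed norms.
  let A' : E → E → ℝ≥0∞ := fun x ξ => A (-x) ξ ^ s
  let B' : E → E → ℝ≥0∞ := fun x ξ => B x (-ξ) ^ s
  have hA' : Measurable (Function.uncurry A') :=
    (hA.comp (measurable_fst.neg.prodMk measurable_snd)).pow_const _
  have hB' : Measurable (Function.uncurry B') :=
    (hB.comp (measurable_fst.prodMk measurable_snd.neg)).pow_const _
  let K : E → E → ℝ≥0∞ := fun x ξ => ∫⁻ η, ∫⁻ y, B' (x - y) (ξ - η) * A' y η
  have hK : Measurable (Function.uncurry K) := by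
    have hm : Measurable fun w : ((E × E) × E) × E =>
        B' (w.1.1.1 - w.2) (w.1.1.2 - w.1.2) * A' w.2 w.1.2 := by
      refine Measurable.mul (hB'.comp (f := fun w : ((E × E) × E) × E =>
        (w.1.1.1 - w.2, w.1.1.2 - w.1.2)) ?_) (hA'.comp (f := fun w : ((E × E) × E) × E =>
        (w.2, w.1.2)) ?_)
      · fun_prop
      · fun_prop
    exact (hm.lintegral_prod_right' (ν := (volume : Measure E))).lintegral_prod_right'
  -- Translate `z` by `(-ζ₂/2, ζ₁/2)` to free `A` of `ζ`, then substitute `y ↦ -y`.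
  have key : ∀ ζ : WithLp 2 (E × E), eLpNorm (fun z : WithLp 2 (E × E) =>
        A (z.fst - (2⁻¹ : ℝ) • ζ.snd) (z.snd + (2⁻¹ : ℝ) • ζ.fst)
          * B (z.fst + (2⁻¹ : ℝ) • ζ.snd) (z.snd - (2⁻¹ : ℝ) • ζ.fst)) p volume
      = K ζ.snd ζ.fst ^ s⁻¹ := by
    intro ζ
    let f : E → E → ℝ≥0∞ := fun x ξ => A x ξ * B (x + ζ.snd) (ξ - ζ.fst)
    have hf : Measurable (Function.uncurry f) :=
      hA.mul (hB.comp ((measurable_fst.add_const _).prodMk (measurable_snd.sub_const _)))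
    have e1 : eLpNorm (fun z : WithLp 2 (E × E) =>
        A (z.fst - (2⁻¹ : ℝ) • ζ.snd) (z.snd + (2⁻¹ : ℝ) • ζ.fst)
          * B (z.fst + (2⁻¹ : ℝ) • ζ.snd) (z.snd - (2⁻¹ : ℝ) • ζ.fst)) p volume
        = eLpNorm (fun z : WithLp 2 (E × E) => f (z.fst + -((2⁻¹ : ℝ) • ζ.snd))
          (z.snd + (2⁻¹ : ℝ) • ζ.fst)) p volume := by
      congr 1
      ext z
      simp only [f]
      congr 2 <;> module
    rw [e1, eLpNorm_shift_eq f hf, eLpNorm_withLp_eq hf,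
      eLpNorm_eq_lintegral_rpow_enorm_toReal h0 ht, one_div]
    congr 1
    simp only [enorm_eq_self, eLpNorm_rpow_toReal_eq_lintegral h0 ht]
    refine lintegral_congr fun η => ?_
    rw [← lintegral_neg_eq_self]
    refine lintegral_congr fun y => ?_
    simp only [f, A', B', ← hs]
    rw [ENNReal.mul_rpow_of_nonneg _ _ hpos.le, mul_comm, neg_add_eq_sub, neg_sub]
  have hone : ∀ {r : ℝ≥0∞}, p ≤ r → 1 ≤ r / p := fun {r} h => by
    rw [ENNReal.le_div_iff_mul_le (Or.inl h0) (Or.inl ht), one_mul]; exact h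
  have young := eLpNorm_eLpNorm_convolution_le (μ := (volume : Measure E))
    (ν := (volume : Measure E)) (hone hp₂) (hone hp₁) (hone hpq) (hone hq₂) (hone hq₁)
    (young_exponent_div h0 ht ((add_comm _ _).trans hpp))
    (young_exponent_div h0 ht ((add_comm _ _).trans hqq)) hB' hA'
  have eA : eLpNorm (fun ξ => eLpNorm (fun x => A' x ξ) (p₁ / p) volume) (q₁ / p)
      (volume : Measure E)
      = eLpNorm (fun ξ => eLpNorm (fun x => A x ξ) p₁ volume) q₁ volume ^ s := by
    rw [← mixed_rpow h0 ht]
    exact mixed_neg_left (f := fun x ξ => A x ξ ^ s) (hA.pow_const _) _ _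
  have eB : eLpNorm (fun ξ => eLpNorm (fun x => B' x ξ) (p₂ / p) volume) (q₂ / p)
      (volume : Measure E)
      = eLpNorm (fun ξ => eLpNorm (fun x => B x ξ) p₂ volume) q₂ volume ^ s := by
    rw [← mixed_rpow h0 ht]
    exact mixed_neg_right (f := fun x ξ => B x ξ ^ s) (hB.pow_const _) _ _
  rw [eA, eB, ← ENNReal.mul_rpow_of_nonneg _ _ hpos.le] at young
  simp_rw [key]
  -- The `L^q` norm of `K^{1/p}` is the `L^{q/p}` norm of `K` to the power `1/p`. That `K` is
  -- evaluated at `(ζ₂, ζ₁)` is harmless, as both variables carry the same exponent.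
  have e2 := eLpNorm_enorm_rpow (μ := (volume : Measure (WithLp 2 (E × E)))) (p := q)
    (fun ζ : WithLp 2 (E × E) => K ζ.snd ζ.fst) (inv_pos.2 hpos)
  have e3 : q * ENNReal.ofReal s⁻¹ = q / p := by
    rw [ENNReal.ofReal_inv_of_pos hpos, hs, ENNReal.ofReal_toReal ht, div_eq_mul_inv]
  simp only [enorm_eq_self, e3] at e2
  rw [e2, eLpNorm_withLp_swap_eq hK]
  calc _ ≤ ((eLpNorm (fun ξ => eLpNorm (fun x => B x ξ) p₂ volume) q₂ volume
        * eLpNorm (fun ξ => eLpNorm (fun x => A x ξ) p₁ volume) q₁ volume) ^ s) ^ s⁻¹ :=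
        ENNReal.rpow_le_rpow young (by positivity)
    _ = _ := by
        rw [← ENNReal.rpow_mul, mul_inv_cancel₀ hpos.ne', ENNReal.rpow_one, mul_comm]

end Bilinear

/-! ### The weighted estimate and the choice of exponents. -/

section MainEstimate

variable {E : Type*} [NormedAddCommGroup E] [InnerProductSpace ℝ E]

/-- The two points differ by `(-ζ₂, ζ₁)`, a rotation of `ζ`, which has the same norm. -/
theorem japaneseBracket_le_vWeight_add {s : ℝ} (hs : 0 ≤ s) (z ζ : WithLp 2 (E × E)) :
    japaneseBracket s ζ ≤ 2 ^ s *
      (vWeight s (z.fst - (2⁻¹ : ℝ) • ζ.snd) (z.snd + (2⁻¹ : ℝ) • ζ.fst)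
        + vWeight s (z.fst + (2⁻¹ : ℝ) • ζ.snd) (z.snd - (2⁻¹ : ℝ) • ζ.fst)) := by
  set a : WithLp 2 (E × E) :=
    WithLp.toLp 2 (z.fst - (2⁻¹ : ℝ) • ζ.snd, z.snd + (2⁻¹ : ℝ) • ζ.fst) with ha
  set b : WithLp 2 (E × E) :=
    WithLp.toLp 2 (z.fst + (2⁻¹ : ℝ) • ζ.snd, z.snd - (2⁻¹ : ℝ) • ζ.fst) with hb
  have hab : ‖a + -b‖ ^ 2 = ‖ζ‖ ^ 2 := by
    have h1 : (a + -b).fst = -ζ.snd := by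
      simp only [ha, hb, WithLp.add_fst, WithLp.neg_fst, WithLp.toLp_fst]
      module
    have h2 : (a + -b).snd = ζ.fst := by
      simp only [ha, hb, WithLp.add_snd, WithLp.neg_snd, WithLp.toLp_snd]
      module
    rw [WithLp.prod_norm_sq_eq_of_L2, WithLp.prod_norm_sq_eq_of_L2, h1, h2, norm_neg, add_comm]
  have h := japaneseBracket_add_le_add hs a (-b)
  have e1 : japaneseBracket s (a + -b) = japaneseBracket s ζ := by
    rw [japaneseBracket, hab, japaneseBracket]
  have e2 : japaneseBracket s (-b) = japaneseBracket s b := by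
    rw [japaneseBracket, norm_neg, japaneseBracket]
  rwa [e1, e2] at h

variable [FiniteDimensional ℝ E] [MeasurableSpace E] [BorelSpace E]

theorem measurable_enorm_stft_mul (g : 𝓢(E, ℂ)) (f : 𝓢'(E, ℂ)) {m : E → E → ℝ}
    (hm : IsModerate m) :
    Measurable (Function.uncurry fun x ξ => ‖stft g f x ξ * (m x ξ : ℂ)‖ₑ) :=
  ((continuous_stft g f).mul (Complex.continuous_ofReal.comp hm.continuous)).enorm.measurable

theorem modulationNorm_eq_enorm (g : 𝓢(E, ℂ)) (p q : ℝ≥0∞) (m : E → E → ℝ) (f : 𝓢'(E, ℂ)) :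
    modulationNorm g p q m f
      = eLpNorm (fun ξ => eLpNorm (fun x => ‖stft g f x ξ * (m x ξ : ℂ)‖ₑ) p volume) q volume := by
  simp only [modulationNorm, mixedNorm, eLpNorm_enorm]

theorem modulationNorm_oneWeight_le (g : 𝓢(E, ℂ)) (p q : ℝ≥0∞) {s : ℝ} (hs : 0 ≤ s)
    (f : 𝓢'(E, ℂ)) : modulationNorm g p q oneWeight f ≤ modulationNorm g p q (vWeight s) f := by
  refine eLpNorm_mono_enorm fun ξ => ?_
  simp only [enorm_eq_self]
  refine eLpNorm_mono fun x => ?_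
  rw [norm_mul, norm_mul]
  gcongr
  simpa [oneWeight, vWeight] using (one_le_japaneseBracket hs _).trans (le_abs_self _)

theorem enorm_stft_crossWigner_mul_le (g : 𝓢(E, ℂ)) (f₁ f₂ : 𝓢'(E, ℂ)) {s : ℝ} (hs : 0 ≤ s)
    (z ζ : WithLp 2 (E × E)) :
    ‖stft (wignerWindow g) (crossWigner f₁ f₂) z ζ * (oneTensorWeight s z ζ : ℂ)‖ₑ
      ≤ ((2 : ℝ≥0) ^ s : ℝ≥0) *
        ((fun x ξ => ‖stft g f₁ x ξ * (oneWeight x ξ : ℂ)‖ₑ)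
            (z.fst - (2⁻¹ : ℝ) • ζ.snd) (z.snd + (2⁻¹ : ℝ) • ζ.fst)
          * (fun x ξ => ‖stft g f₂ x ξ * (vWeight s x ξ : ℂ)‖ₑ)
            (z.fst + (2⁻¹ : ℝ) • ζ.snd) (z.snd - (2⁻¹ : ℝ) • ζ.fst)
        + (fun x ξ => ‖stft g f₁ x ξ * (vWeight s x ξ : ℂ)‖ₑ)
            (z.fst - (2⁻¹ : ℝ) • ζ.snd) (z.snd + (2⁻¹ : ℝ) • ζ.fst)
          * (fun x ξ => ‖stft g f₂ x ξ * (oneWeight x ξ : ℂ)‖ₑ)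
            (z.fst + (2⁻¹ : ℝ) • ζ.snd) (z.snd - (2⁻¹ : ℝ) • ζ.fst)) := by
  simp only [enorm_mul, enorm_stft_crossWigner, oneWeight, Complex.ofReal_one, mul_one,
    oneTensorWeight]
  have hw : ∀ {r : ℝ}, 0 ≤ r → ‖(r : ℂ)‖ₑ = ENNReal.ofReal r := fun {r} hr => by
    rw [← ofReal_norm, Complex.norm_real, Real.norm_of_nonneg hr]
  have hc : (((2 : ℝ≥0) ^ s : ℝ≥0) : ℝ≥0∞) = ENNReal.ofReal (2 ^ s) := by
    rw [ENNReal.ofReal, Real.toNNReal_rpow_of_nonneg (by norm_num)]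
    simp
  have hv : ∀ x ξ : E, 0 ≤ vWeight s x ξ := fun x ξ => japaneseBracket_nonneg _ _
  rw [hw (japaneseBracket_nonneg _ _), hw (hv _ _), hw (hv _ _), hc]
  have h := ENNReal.ofReal_le_ofReal (japaneseBracket_le_vWeight_add hs z ζ)
  rw [ENNReal.ofReal_mul (by positivity), ENNReal.ofReal_add (hv _ _) (hv _ _)] at h
  refine (mul_le_mul_right h _).trans_eq ?_
  ring

theorem measurable_wigner_product {A B : E → E → ℝ≥0∞} (hA : Measurable (Function.uncurry A))
    (hB : Measurable (Function.uncurry B)) :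
    Measurable (Function.uncurry fun z ζ : WithLp 2 (E × E) =>
      A (z.fst - (2⁻¹ : ℝ) • ζ.snd) (z.snd + (2⁻¹ : ℝ) • ζ.fst)
        * B (z.fst + (2⁻¹ : ℝ) • ζ.snd) (z.snd - (2⁻¹ : ℝ) • ζ.fst)) := by
  have hf : Measurable fun z : WithLp 2 (E × E) => z.fst :=
    measurable_fst.comp (WithLp.volume_preserving_ofLp E E).measurable
  have hs : Measurable fun z : WithLp 2 (E × E) => z.snd :=
    measurable_snd.comp (WithLp.volume_preserving_ofLp E E).measurable
  refine Measurable.mul (hA.comp (f := fun w : WithLp 2 (E × E) × WithLp 2 (E × E) =>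
      (w.1.fst - (2⁻¹ : ℝ) • w.2.snd, w.1.snd + (2⁻¹ : ℝ) • w.2.fst)) ?_)
    (hB.comp (f := fun w : WithLp 2 (E × E) × WithLp 2 (E × E) =>
      (w.1.fst + (2⁻¹ : ℝ) • w.2.snd, w.1.snd - (2⁻¹ : ℝ) • w.2.fst)) ?_)
  · exact ((hf.comp measurable_fst).sub ((hs.comp measurable_snd).const_smul _)).prodMk
      ((hs.comp measurable_fst).add ((hf.comp measurable_snd).const_smul _))
  · exact ((hf.comp measurable_fst).add ((hs.comp measurable_snd).const_smul _)).prodMk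
      ((hs.comp measurable_fst).sub ((hf.comp measurable_snd).const_smul _))

theorem eLpNorm_eLpNorm_add_le {α β : Type*} [MeasurableSpace α] [MeasurableSpace β]
    {μ : Measure α} {ν : Measure β} [SFinite μ] {p q : ℝ≥0∞} (hp : 1 ≤ p) (hq : 1 ≤ q)
    {X Y : α → β → ℝ≥0∞} (hX : Measurable (Function.uncurry X))
    (hY : Measurable (Function.uncurry Y)) :
    eLpNorm (fun ζ => eLpNorm (fun z => X z ζ + Y z ζ) p μ) q ν
      ≤ eLpNorm (fun ζ => eLpNorm (fun z => X z ζ) p μ) q ν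
        + eLpNorm (fun ζ => eLpNorm (fun z => Y z ζ) p μ) q ν := by
  refine le_trans (eLpNorm_mono_enorm (g := fun ζ => eLpNorm (fun z => X z ζ) p μ
    + eLpNorm (fun z => Y z ζ) p μ) fun ζ => ?_) (eLpNorm_add_le
    (measurable_eLpNorm_left hX p).aestronglyMeasurable
    (measurable_eLpNorm_left hY p).aestronglyMeasurable hq)
  simp only [enorm_eq_self]
  exact eLpNorm_add_le (hX.comp measurable_prodMk_right).aestronglyMeasurable
    (hY.comp measurable_prodMk_right).aestronglyMeasurable hp

/-- The estimate for the window `W(g, g)`. -/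
theorem modulationNorm_crossWigner_le {p q p₁ p₂ q₁ q₂ : ℝ≥0∞} (hp : 1 ≤ p) (hpq : p ≤ q)
    (hp₁ : p ≤ p₁) (hp₂ : p ≤ p₂) (hq₁ : p ≤ q₁) (hq₂ : p ≤ q₂)
    (hpp : p₁⁻¹ + p₂⁻¹ = p⁻¹ + q⁻¹) (hqq : q₁⁻¹ + q₂⁻¹ = p⁻¹ + q⁻¹) {s : ℝ} (hs : 0 ≤ s)
    (g : 𝓢(E, ℂ)) (f₁ f₂ : 𝓢'(E, ℂ)) :
    modulationNorm (wignerWindow g) p q (oneTensorWeight s) (crossWigner f₁ f₂)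
      ≤ ((2 : ℝ≥0) ^ s : ℝ≥0) *
        (modulationNorm g p₁ q₁ oneWeight f₁ * modulationNorm g p₂ q₂ (vWeight s) f₂
          + modulationNorm g p₁ q₁ (vWeight s) f₁ * modulationNorm g p₂ q₂ oneWeight f₂) := by
  have h1 := fun f => measurable_enorm_stft_mul g f (isModerate_oneWeight (V := E))
  have hv := fun f => measurable_enorm_stft_mul g f (isModerate_vWeight (V := E) hs)
  rw [modulationNorm_eq_enorm g p₁, modulationNorm_eq_enorm g p₁, modulationNorm_eq_enorm g p₂,
    modulationNorm_eq_enorm g p₂]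
  refine le_trans ?_ (mul_le_mul_right (add_le_add
    (eLpNorm_eLpNorm_wigner_le hp hpq hp₁ hp₂ hq₁ hq₂ hpp hqq (h1 f₁) (hv f₂))
    (eLpNorm_eLpNorm_wigner_le hp hpq hp₁ hp₂ hq₁ hq₂ hpp hqq (hv f₁) (h1 f₂))) _)
  refine le_trans ?_ (mul_le_mul_right (eLpNorm_eLpNorm_add_le hp (hp.trans hpq)
    (measurable_wigner_product (h1 f₁) (hv f₂)) (measurable_wigner_product (hv f₁) (h1 f₂))) _)
  refine eLpNorm_le_nnreal_smul_eLpNorm_of_ae_le_mul'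
    (Filter.Eventually.of_forall fun ζ => ?_) q
  rw [enorm_eq_self, enorm_eq_self]
  refine eLpNorm_le_nnreal_smul_eLpNorm_of_ae_le_mul'
    (Filter.Eventually.of_forall fun z => ?_) p
  rw [enorm_eq_self]
  exact enorm_stft_crossWigner_mul_le g f₁ f₂ hs z ζ

/-- Take `1/t₁ = min (1/r₁) (1/p)` and let the equality define `t₂`. If the minimum is `1/r₁`, then
`r₂ ≤ t₂` is the hypothesis on the sums; if it is `1/p`, it follows from `r₂ ≤ q`. Finally `p ≤ t₂`
says that `1/q` is at most the minimum, which holds since `r₁ ≤ q` and `p ≤ q`. -/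
theorem exists_exponents {p q r₁ r₂ : ℝ≥0∞} (hpq : p ≤ q) (hp : 1 ≤ p) (h₁ : r₁ ≤ q) (h₂ : r₂ ≤ q)
    (h : p⁻¹ + q⁻¹ ≤ r₁⁻¹ + r₂⁻¹) :
    ∃ t₁ t₂ : ℝ≥0∞, r₁ ≤ t₁ ∧ r₂ ≤ t₂ ∧ p ≤ t₁ ∧ p ≤ t₂ ∧ t₁⁻¹ + t₂⁻¹ = p⁻¹ + q⁻¹ := by
  have hp' : p⁻¹ ≠ ∞ := ENNReal.inv_ne_top.2 (zero_lt_one.trans_le hp).ne'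
  have hq' : q⁻¹ ≠ ∞ := ENNReal.inv_ne_top.2 (zero_lt_one.trans_le (hp.trans hpq)).ne'
  have hqp : q⁻¹ ≤ p⁻¹ := ENNReal.inv_le_inv.2 hpq
  have hmt : min r₁⁻¹ p⁻¹ ≠ ∞ := ne_top_of_le_ne_top hp' (min_le_right _ _)
  have hle : min r₁⁻¹ p⁻¹ ≤ p⁻¹ + q⁻¹ := (min_le_right _ _).trans le_self_add
  refine ⟨(min r₁⁻¹ p⁻¹)⁻¹, (p⁻¹ + q⁻¹ - min r₁⁻¹ p⁻¹)⁻¹, ?_, ?_, ?_, ?_, ?_⟩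
  · rw [ENNReal.le_inv_iff_le_inv]; exact min_le_left _ _
  · rw [ENNReal.le_inv_iff_le_inv, tsub_le_iff_left]
    rcases min_choice r₁⁻¹ p⁻¹ with e | e <;> rw [e]
    · exact h
    · gcongr
  · rw [ENNReal.le_inv_iff_le_inv]; exact min_le_right _ _
  · rw [ENNReal.le_inv_iff_le_inv, tsub_le_iff_left, add_comm]
    gcongr
    exact le_min (ENNReal.inv_le_inv.2 h₁) hqp
  · rw [inv_inv, inv_inv, add_tsub_cancel_of_le hle]

end MainEstimate

end TimeFreq

end

/-! ### Reduction to the critical exponents and conclusion. -/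

theorem theorem3p3 (d : ℕ) (p₁ q₁ p₂ q₂ p q : ℝ≥0∞)
    (hp₁ : 1 ≤ p₁) (hq₁ : 1 ≤ q₁) (hp₂ : 1 ≤ p₂) (hq₂ : 1 ≤ q₂) (hp : 1 ≤ p) (hq : 1 ≤ q)
    (hp₁q : p₁ ≤ q) (hq₁q : q₁ ≤ q) (hp₂q : p₂ ≤ q) (hq₂q : q₂ ≤ q)
    (hpp : p⁻¹ + q⁻¹ ≤ p₁⁻¹ + p₂⁻¹) (hqq : p⁻¹ + q⁻¹ ≤ q₁⁻¹ + q₂⁻¹)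
    (s : ℝ) (hs : 0 ≤ s)
    (g : 𝓢(EuclideanSpace ℝ (Fin d), ℂ)) (hg : g ≠ 0)
    (Φ : 𝓢(WithLp 2 (EuclideanSpace ℝ (Fin d) × EuclideanSpace ℝ (Fin d)), ℂ)) (hΦ : Φ ≠ 0) :
    ∃ C : ℝ≥0, ∀ f₁ f₂ : 𝓢'(EuclideanSpace ℝ (Fin d), ℂ),
      f₁ ∈ TimeFreq.modulationSpace g p₁ q₁ (TimeFreq.vWeight s) →
      f₂ ∈ TimeFreq.modulationSpace g p₂ q₂ (TimeFreq.vWeight s) →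
      TimeFreq.crossWigner f₁ f₂ ∈
          TimeFreq.modulationSpace Φ p q (TimeFreq.oneTensorWeight s) ∧
        TimeFreq.modulationNorm Φ p q (TimeFreq.oneTensorWeight s) (TimeFreq.crossWigner f₁ f₂) ≤
          C * (TimeFreq.modulationNorm g p₁ q₁ TimeFreq.oneWeight f₁ *
                TimeFreq.modulationNorm g p₂ q₂ (TimeFreq.vWeight s) f₂ +
              TimeFreq.modulationNorm g p₁ q₁ (TimeFreq.vWeight s) f₁ *
                TimeFreq.modulationNorm g p₂ q₂ TimeFreq.oneWeight f₂) := by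
  -- The exponent `min p q` replaces `p`, because the bilinear estimate needs `p ≤ q`. If the
  -- minimum is `q`, the relation survives because both exponents are at most `q`.
  have hsum : ∀ {r₁ r₂ : ℝ≥0∞}, r₁ ≤ q → r₂ ≤ q → p⁻¹ + q⁻¹ ≤ r₁⁻¹ + r₂⁻¹ →
      (min p q)⁻¹ + q⁻¹ ≤ r₁⁻¹ + r₂⁻¹ := by
    intro r₁ r₂ h₁ h₂ h
    rcases min_choice p q with e | e <;> rw [e]
    · exact h
    · exact add_le_add (ENNReal.inv_le_inv.2 h₁) (ENNReal.inv_le_inv.2 h₂)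
  obtain ⟨a₁, a₂, ha₁, ha₂, hpa₁, hpa₂, ha⟩ := TimeFreq.exists_exponents (min_le_right p q)
    (le_min hp hq) hp₁q hp₂q (hsum hp₁q hp₂q hpp)
  obtain ⟨b₁, b₂, hb₁, hb₂, hpb₁, hpb₂, hb⟩ := TimeFreq.exists_exponents (min_le_right p q)
    (le_min hp hq) hq₁q hq₂q (hsum hq₁q hq₂q hqq)
  -- One application changes the window from `W(g, g)` to `Φ` and raises `min p q` back to `p`.
  obtain ⟨K, hK⟩ := TimeFreq.exists_modulationNorm_le (TimeFreq.wignerWindow_ne_zero hg) Φ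
    (TimeFreq.isModerate_oneTensorWeight hs) (le_min hp hq) (min_le_left p q) hq (le_refl q)
  -- Here and in the next three the window stays `g` and only the exponents rise, for the trivial
  -- weight (`K₁`, `K₂`) and for `v_s` (`L₁`, `L₂`).
  obtain ⟨K₁, hK₁⟩ := TimeFreq.exists_modulationNorm_le hg g TimeFreq.isModerate_oneWeight
    hp₁ ha₁ hq₁ hb₁
  obtain ⟨K₂, hK₂⟩ := TimeFreq.exists_modulationNorm_le hg g TimeFreq.isModerate_oneWeight
    hp₂ ha₂ hq₂ hb₂
  obtain ⟨L₁, hL₁⟩ := TimeFreq.exists_modulationNorm_le hg g (TimeFreq.isModerate_vWeight hs)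
    hp₁ ha₁ hq₁ hb₁
  obtain ⟨L₂, hL₂⟩ := TimeFreq.exists_modulationNorm_le hg g (TimeFreq.isModerate_vWeight hs)
    hp₂ ha₂ hq₂ hb₂
  set M : ℝ≥0 := K₁ * L₂ + L₁ * K₂ with hM
  set C : ℝ≥0 := K * (2 ^ s * M) with hC
  refine ⟨C, fun f₁ f₂ hf₁ hf₂ => ?_⟩
  have hM₁ : K₁ * L₂ ≤ M := le_self_add
  have hM₂ : L₁ * K₂ ≤ M := le_add_self
  have bound : TimeFreq.modulationNorm Φ p q (TimeFreq.oneTensorWeight s)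
      (TimeFreq.crossWigner f₁ f₂) ≤
        C * (TimeFreq.modulationNorm g p₁ q₁ TimeFreq.oneWeight f₁ *
              TimeFreq.modulationNorm g p₂ q₂ (TimeFreq.vWeight s) f₂ +
            TimeFreq.modulationNorm g p₁ q₁ (TimeFreq.vWeight s) f₁ *
              TimeFreq.modulationNorm g p₂ q₂ TimeFreq.oneWeight f₂) := by
    refine (hK _).trans ?_
    rw [hC, ENNReal.coe_mul, mul_assoc]
    gcongr
    refine (TimeFreq.modulationNorm_crossWigner_le (le_min hp hq) (min_le_right p q)
      hpa₁ hpa₂ hpb₁ hpb₂ ha hb hs g f₁ f₂).trans ?_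
    rw [ENNReal.coe_mul, mul_assoc]
    gcongr
    rw [mul_add]
    refine add_le_add ?_ ?_
    · refine (mul_le_mul' (hK₁ f₁) (hL₂ f₂)).trans ?_
      rw [mul_mul_mul_comm, ← ENNReal.coe_mul]
      gcongr
    · refine (mul_le_mul' (hL₁ f₁) (hK₂ f₂)).trans ?_
      rw [mul_mul_mul_comm, ← ENNReal.coe_mul]
      gcongr
  refine ⟨bound.trans_lt ?_, bound⟩
  -- Finiteness of the unweighted norms follows from `1 ≤ v_s`.
  have g₁ := (TimeFreq.modulationNorm_oneWeight_le g p₁ q₁ hs f₁).trans_lt hf₁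
  have g₂ := (TimeFreq.modulationNorm_oneWeight_le g p₂ q₂ hs f₂).trans_lt hf₂
  exact ENNReal.mul_lt_top ENNReal.coe_lt_top
    (ENNReal.add_lt_top.2 ⟨ENNReal.mul_lt_top g₁ hf₂, ENNReal.mul_lt_top hf₁ g₂⟩)
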